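/- Let $(V, D\,\dot\cup\,E)$ range over the finite connected multigraphs $G+H$ (loops and parallel edges allowed) whose edge set is partitioned into the demand edges $D$ (the edges of $H$) and the supply edges $E$ (the edges of $G$). A $D$-cycle is (the edge set of) a cycle of $G+H$ that contains exactly one edge of $D$. A $D$-cut is an edge set $\delta(U)$ that contains exactly one edge of $D$, where $U\subseteq V$ is such that $U$ and $V\setminus U$ both induce connected subgraphs of $G+H$. The $D$-cut covering LP is $$\min\Big\{\sum_{e\in D\cup E} y_e \;:\; \sum_{e\in C} y_e\ge 1 \text{ for every } D\text{-cut } C,\;\; y_e\ge 0 \text{ for every } e\in D\cup E\Big\},$$ and the $D$-cycle covering LP is defined in the same way with $D$-cycles in place of $D$-cuts. The integrality gap of such an LP over a class of instances is the supremum, over the instances of the class in which the LP optimum is positive, of the ratio of the minimum of $\sum_e y_e$ over the integral feasible solutions and the minimum of $\sum_e y_e$ over all feasible solutions. (If the LP optimum is $0$, so is the integral one.) Then the integrality gap of the $D$-cut covering LP (over all instances) is at most $2$, and the integrality gap of the $D$-cycle covering LP over the instances with $G+H$ planar is at most $2$. Moreover, even when restricted to the instances with $G+H$ planar, the integrality gap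 of the $D$-cut covering LP and that of the $D$-cycle covering LP are both at least $\frac32$. -/

import Mathlib

open scoped ENNReal Graph

noncomputable section

namespace DCover

/-- A multigraph is connected: it has a vertex, and any two vertices are joined by a walk. -/
def IsConnected {α β : Type*} (G : Graph α β) : Prop :=
  V(G).Nonempty ∧ ∀ x ∈ V(G), ∀ y ∈ V(G), Relation.ReflTransGen G.Adj x y

/-- The cut `δ(U)`: all edges with one end in `U` and the other end outside `U`. -/
def cut {α β : Type*} (G : Graph α β) (U : Set α) : Set β :=
  {e | ∃ x y, G.IsLink e x y ∧ x ∈ U ∧ y ∉ U}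

/-- `C` is a simple cut: `C = δ(U)` where `U` and its complement both induce connected subgraphs. -/
def IsSimpleCut {α β : Type*} (G : Graph α β) (C : Set β) : Prop :=
  ∃ U : Set α, U ⊆ V(G) ∧ IsConnected (G.induce U) ∧ IsConnected (G.induce (V(G) \ U)) ∧
    C = cut G U

/-- `C` is (the edge set of) a cycle: `C = {e₀, …, eₙ}` with distinct `eᵢ`, for which there are
distinct vertices `v₀, …, vₙ` such that `eᵢ` has the ends `vᵢ` and `vᵢ₊₁`, indices being taken
modulo `n + 1`. Loops (`n = 0`) and pairs of parallel edges (`n = 1`) are cycles. -/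
def IsCycle {α β : Type*} (G : Graph α β) (C : Set β) : Prop :=
  ∃ (n : ℕ) (v : Fin (n + 1) → α) (e : Fin (n + 1) → β),
    Function.Injective v ∧ Function.Injective e ∧ Set.range e = C ∧
      ∀ i, G.IsLink (e i) (v i) (v (i + 1))

/-- An instance: a finite connected multigraph `G + H = (V, D ∪ E)`, with loops and parallel edges
allowed, together with the set `D` of its demand edges; the other edges are the supply edges. -/
structure Inst where
  /-- the vertices -/
  Vert : Type
  /-- the edges, both demand and supply -/
  Edge : Type
  [fintypeVert : Fintype Vert]
  [fintypeEdge : Fintype Edge]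
  /-- the multigraph `G + H` -/
  graph : Graph Vert Edge
  vertexSet_eq : V(graph) = Set.univ
  edgeSet_eq : E(graph) = Set.univ
  connected : IsConnected graph
  /-- the set `D` of demand edges -/
  demand : Set Edge

attribute [instance] Inst.fintypeVert Inst.fintypeEdge

/-- The `D`-cuts: the simple cuts that contain exactly one demand edge. -/
def dCuts (I : Inst) : Set (Finset I.Edge) :=
  {C | IsSimpleCut I.graph (C : Set I.Edge) ∧ ∃! e, e ∈ C ∧ e ∈ I.demand}

/-- The `D`-cycles: the cycles that contain exactly one demand edge. -/
def dCycles (I : Inst) : Set (Finset I.Edge) :=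
  {C | IsCycle I.graph (C : Set I.Edge) ∧ ∃! e, e ∈ C ∧ e ∈ I.demand}

/-! ### Planarity, by combinatorial embeddings

A dart `(e, b)` is an edge with one of its two directions. -/

/-- The reversal of darts. -/
def rev (β : Type*) : Equiv.Perm (β × Bool) :=
  (Equiv.refl β).prodCongr Equiv.boolNot

/-- The number of faces of the combinatorial embedding with rotation system `σ`: the number of
orbits of the face tracing permutation, which takes a dart `d` to the dart that follows the
reversal of `d` in the rotation at the head of `d`. If there is no edge, there is one face. -/
def faceCount {β : Type*} (σ : Equiv.Perm (β × Bool)) : ℕ :=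
  open Classical in
  if IsEmpty β then 1 else Nat.card (Quotient (Equiv.Perm.SameCycle.setoid (σ * rev β)))

/-- The connected multigraph of the instance is planar: it has a combinatorial embedding in the
sphere. Here `tail` gives each dart its initial vertex, `σ` is a rotation system (the cycles of `σ`
are exactly the cyclic orders of the darts that leave a common vertex), and Euler's formula says
that the surface obtained by gluing a disc to every face is the sphere. -/
def IsPlanar (I : Inst) : Prop :=
  ∃ (tail : I.Edge × Bool → I.Vert) (σ : Equiv.Perm (I.Edge × Bool)),
    (∀ e, I.graph.IsLink e (tail (e, false)) (tail (e, true))) ∧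
    (∀ d d', σ.SameCycle d d' ↔ tail d = tail d') ∧
    (Fintype.card I.Vert : ℤ) - Fintype.card I.Edge + faceCount σ = 2

/-! ### Covering LPs and integrality gaps -/

/-- The feasible solutions of the covering LP of a family `F` of edge sets:
`∑_{e ∈ C} y_e ≥ 1` for all `C ∈ F`, and `y ≥ 0`. -/
def coverFeasible {β : Type*} (F : Set (Finset β)) : Set (β → ℝ) :=
  {y | (∀ C ∈ F, 1 ≤ ∑ e ∈ C, y e) ∧ ∀ e, 0 ≤ y e}

/-- The vectors with integral entries. -/
def integral (β : Type*) : Set (β → ℝ) :=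
  {y | ∀ e, ∃ n : ℤ, y e = n}

/-- The value of the covering LP: the infimum of `∑ y_e` over all feasible `y`. -/
def lpValue {β : Type*} [Fintype β] (F : Set (Finset β)) : ℝ≥0∞ :=
  ⨅ y ∈ coverFeasible F, ENNReal.ofReal (∑ e, y e)

/-- The value of the integer program: the infimum of `∑ y_e` over all integral feasible `y`. -/
def ipValue {β : Type*} [Fintype β] (F : Set (Finset β)) : ℝ≥0∞ :=
  ⨅ y ∈ coverFeasible F ∩ integral β, ENNReal.ofReal (∑ e, y e)

/-- The integrality gap, over the class `P` of instances, of the covering LP of the family `F I` of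
edge sets of an instance `I`: the supremum of the ratio of the integral optimum and the LP optimum.
A positive number divided by `0` is `∞`, and `0 / 0 = 0` (an instance in which both optima vanish
does not contribute to the supremum). -/
def integralityGap (P : Inst → Prop) (F : (I : Inst) → Set (Finset I.Edge)) : ℝ≥0∞ :=
  ⨆ (I : Inst) (_ : P I), ipValue (F I) / lpValue (F I)

end DCover

end

/-! Upper bounds. Call a vertex set required if exactly one demand edge crosses it. By submodularity
and parity of the number of crossing demand edges, required sets are uncrossable
(`uncrossable_card_eq_one`). For every uncrossable requirement, the primal-dual method in
local-ratio form loses at most a factor 2 against any fractional cover (`Uncrossable.exists_cover`).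
What makes it work is that the edges of an inclusion-minimal cover leave a minimal required set at
most twice on average (`sum_card_minimal_crossed_le`), which is proved by a laminar family of
witness sets. Restricting to simple cuts changes nothing, because a cut with one demand edge
contains a simple cut through that edge (`exists_simpleCut`).

For planar instances, `D`-cycles are handled by duality, done algebraically over `ZMod 2`. The
face-edge and vertex-edge incidence matrices compose to zero, and Euler's formula makes this
sequence exact, so every cycle bounds a set of faces. Conversely, the boundary of a set of faces
contains a cycle through each of its edges. Covering `D`-cycles is thus covering cuts of the dual
with one demand edge (`coverFeasible_dCycles`).

Lower bounds. Double every vertex of a path and take half of the edges of each level as demand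
edges. The graph is bipartite without parallel edges, so a `D`-cycle has at least three supply
edges, and 1/3 on each supply edge is a fractional cover of value 2(k+1)/3. An integral cover that
takes no supply edge on some level pays at least 2 on the next level, hence at least k in total. The
ratios tend to 3/2, and the plane duals (`exists_dual`) give the same bound for cuts. -/

namespace DCover

/-! ### Uncrossable requirements and their factor-2 covering theorem. -/

section Uncrossable

open Classical

variable {α β : Type*} {s t : β → α} {h : Finset α → Prop} {F : Finset β}

/-- The edge `e` with the ends `s e` and `t e` lies in the cut `δ(S)`. -/
def Crosses (s t : β → α) (S : Finset α) (e : β) : Prop := ¬(s e ∈ S ↔ t e ∈ S)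

/-- A requirement on vertex sets is uncrossable. -/
def Uncrossable (h : Finset α → Prop) : Prop :=
  ∀ A B, h A → h B → (h (A ∩ B) ∧ h (A ∪ B)) ∨ (h (A \ B) ∧ h (B \ A))

/-- The edge set `F` meets every cut required by `h`. -/
def Covers (s t : β → α) (h : Finset α → Prop) (F : Finset β) : Prop :=
  ∀ S, h S → ∃ e ∈ F, Crosses s t S e

/-- `S` is a required set whose cut meets `F` in `e` only. -/
def IsWitness (s t : β → α) (h : Finset α → Prop) (F : Finset β) (S : Finset α) (e : β) : Prop :=
  h S ∧ ∀ f ∈ F, Crosses s t S f ↔ f = e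

lemma Crosses.of_inter_or_union {A B : Finset α} {e : β}
    (he : Crosses s t (A ∩ B) e ∨ Crosses s t (A ∪ B) e) : Crosses s t A e ∨ Crosses s t B e := by
  simp only [Crosses, Finset.mem_inter, Finset.mem_union] at *
  tauto

lemma Crosses.of_sdiff {A B : Finset α} {e : β}
    (he : Crosses s t (A \ B) e ∨ Crosses s t (B \ A) e) : Crosses s t A e ∨ Crosses s t B e := by
  simp only [Crosses, Finset.mem_sdiff] at *
  tauto

/-- Both ends of `e` lie on the same side of `B`: inside, `e` crosses only the intersection;
outside, only the union. -/
lemma Crosses.inter_iff_not_union {A B : Finset α} {e : β} (hA : Crosses s t A e)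
    (hB : ¬ Crosses s t B e) : Crosses s t (A ∩ B) e ↔ ¬ Crosses s t (A ∪ B) e := by
  simp only [Crosses, Finset.mem_inter, Finset.mem_union] at *
  tauto

lemma Crosses.sdiff_iff_not_sdiff {A B : Finset α} {e : β} (hA : Crosses s t A e)
    (hB : ¬ Crosses s t B e) : Crosses s t (A \ B) e ↔ ¬ Crosses s t (B \ A) e := by
  simp only [Crosses, Finset.mem_sdiff] at *
  tauto

/-- This is the residual requirement after buying `z`; it keeps the induction in
`Uncrossable.exists_cover` going. -/
lemma Uncrossable.and_not_crosses (hh : Uncrossable h) (z : β) :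
    Uncrossable fun S => h S ∧ ¬ Crosses s t S z := by
  rintro A B ⟨hA, zA⟩ ⟨hB, zB⟩
  have h1 := fun H => (Crosses.of_inter_or_union (s := s) (t := t) (A := A) (B := B) (e := z) H)
  have h2 := fun H => (Crosses.of_sdiff (s := s) (t := t) (A := A) (B := B) (e := z) H)
  rcases hh A B hA hB with H | H
  · exact Or.inl ⟨⟨H.1, fun H' => (h1 (Or.inl H')).elim zA zB⟩,
      ⟨H.2, fun H' => (h1 (Or.inr H')).elim zA zB⟩⟩
  · exact Or.inr ⟨⟨H.1, fun H' => (h2 (Or.inl H')).elim zA zB⟩,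
      ⟨H.2, fun H' => (h2 (Or.inr H')).elim zA zB⟩⟩

lemma card_crosses_inter_union (s t : β → α) (D : Finset β) (A B : Finset α) :
    (D.filter (Crosses s t (A ∩ B))).card + (D.filter (Crosses s t (A ∪ B))).card ≤
      (D.filter (Crosses s t A)).card + (D.filter (Crosses s t B)).card := by
  simp only [Finset.card_filter, ← Finset.sum_add_distrib]
  refine Finset.sum_le_sum fun e _ => ?_
  simp only [Crosses, Finset.mem_inter, Finset.mem_union]
  by_cases h1 : s e ∈ A <;> by_cases h2 : s e ∈ B <;> by_cases h3 : t e ∈ A <;>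
    by_cases h4 : t e ∈ B <;> simp [h1, h2, h3, h4]

lemma card_crosses_sdiff (s t : β → α) (D : Finset β) (A B : Finset α) :
    (D.filter (Crosses s t (A \ B))).card + (D.filter (Crosses s t (B \ A))).card ≤
      (D.filter (Crosses s t A)).card + (D.filter (Crosses s t B)).card := by
  simp only [Finset.card_filter, ← Finset.sum_add_distrib]
  refine Finset.sum_le_sum fun e _ => ?_
  simp only [Crosses, Finset.mem_sdiff]
  by_cases h1 : s e ∈ A <;> by_cases h2 : s e ∈ B <;> by_cases h3 : t e ∈ A <;>
    by_cases h4 : t e ∈ B <;> simp [h1, h2, h3, h4]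

/-- An edge crossing both disjoint sets joins them and does not cross the union, so it is counted
twice on the right and not at all on the left. -/
lemma card_crosses_disjoint (s t : β → α) (D : Finset β) {A B : Finset α} (hAB : Disjoint A B) :
    (D.filter (Crosses s t (A ∪ B))).card % 2 =
      ((D.filter (Crosses s t A)).card + (D.filter (Crosses s t B)).card) % 2 := by
  have key : (D.filter (Crosses s t (A ∪ B))).card +
      2 * (D.filter fun e => Crosses s t A e ∧ Crosses s t B e).card =
      (D.filter (Crosses s t A)).card + (D.filter (Crosses s t B)).card := by
    simp only [Finset.card_filter, ← Finset.sum_add_distrib, Finset.mul_sum]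
    refine Finset.sum_congr rfl fun e _ => ?_
    have hs : s e ∈ A → s e ∉ B := fun h => Finset.disjoint_left.1 hAB h
    have ht : t e ∈ A → t e ∉ B := fun h => Finset.disjoint_left.1 hAB h
    simp only [Crosses, Finset.mem_union]
    by_cases h1 : s e ∈ A <;> by_cases h2 : s e ∈ B <;> by_cases h3 : t e ∈ A <;>
      by_cases h4 : t e ∈ B <;> simp_all
  omega

/-- The sets whose cut contains exactly one edge of `D` are uncrossable. -/
lemma uncrossable_card_eq_one (s t : β → α) (D : Finset β) :
    Uncrossable fun S => (D.filter (Crosses s t S)).card = 1 := by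
  intro A B hA hB
  have h1 := card_crosses_inter_union s t D A B
  have h2 := card_crosses_sdiff s t D A B
  have h3 := card_crosses_disjoint s t D (Finset.disjoint_sdiff_inter A B)
  have h4 := card_crosses_disjoint s t D (Finset.disjoint_sdiff_inter B A)
  have h5 := card_crosses_disjoint s t D (A := A) (B := B \ A) Finset.disjoint_sdiff
  rw [Finset.sdiff_union_inter] at h3 h4
  rw [Finset.union_sdiff_self_eq_union] at h5
  rw [Finset.inter_comm B A] at h4
  simp only at hA hB ⊢
  -- By parity, either `A ∩ B` and `A ∪ B` are both crossed an odd number of times, or `A \ B` and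
  -- `B \ A` are. The corresponding sum is at most 2, so both numbers are 1.
  omega

/-! ### Laminar witness families -/

lemma exists_witness (hF : ∀ e ∈ F, ¬ Covers s t h (F.erase e)) (hc : Covers s t h F) {e : β}
    (he : e ∈ F) : ∃ S, IsWitness s t h F S e := by
  have := hF e he
  simp only [Covers, not_forall, not_exists, not_and] at this
  obtain ⟨S, hS, hn⟩ := this
  obtain ⟨f, hf, hfS⟩ := hc S hS
  have key : ∀ g ∈ F, Crosses s t S g → g = e := fun g hg hgS => by
    by_contra hne
    exact hn g (Finset.mem_erase.2 ⟨hne, hg⟩) hgS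
  refine ⟨S, hS, fun g hg => ⟨key g hg, ?_⟩⟩
  rintro rfl
  rwa [← key f hf hfS]

/-- Only `e` and `f` among the edges of `F` can cross `S` or `T`, and each of them crosses exactly
one. As `F` covers both sets, the two edges cross different ones, so `S` and `T` can replace `A` and
`B` as witnesses, in some order. -/
lemma IsWitness.swap (hc : Covers s t h F) {A B S T : Finset α} {e f : β}
    (hf : f ∈ F) (hef : e ≠ f) (he : e ∈ F)
    (hA : IsWitness s t h F A e) (hB : IsWitness s t h F B f) (hS : h S) (hT : h T)
    (hST : ∀ g, Crosses s t S g ∨ Crosses s t T g → Crosses s t A g ∨ Crosses s t B g)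
    (h1 : Crosses s t S e ↔ ¬ Crosses s t T e) (h2 : Crosses s t S f ↔ ¬ Crosses s t T f) :
    (IsWitness s t h F S e ∧ IsWitness s t h F T f) ∨
      (IsWitness s t h F T e ∧ IsWitness s t h F S f) := by
  have key : ∀ g ∈ F, Crosses s t S g ∨ Crosses s t T g → g = e ∨ g = f := fun g hg H =>
    (hST g H).imp (hA.2 g hg).1 (hB.2 g hg).1
  have main : ∀ S' T' : Finset α, (∀ g ∈ F, Crosses s t S' g ∨ Crosses s t T' g → g = e ∨ g = f) →
      h S' → h T' → (Crosses s t S' e ↔ ¬ Crosses s t T' e) →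
      (Crosses s t S' f ↔ ¬ Crosses s t T' f) → Crosses s t S' e →
      IsWitness s t h F S' e ∧ IsWitness s t h F T' f := by
    intro S' T' key hS hT h1 h2 h3
    have h4 : ¬ Crosses s t T' e := h1.1 h3
    have h5 : Crosses s t T' f := by
      obtain ⟨g, hg, hgT⟩ := hc T' hT
      rcases key g hg (Or.inr hgT) with rfl | rfl
      · exact absurd hgT h4
      · exact hgT
    have h6 : ¬ Crosses s t S' f := fun H => h2.1 H h5
    refine ⟨⟨hS, fun g hg => ⟨fun H => ?_, by rintro rfl; exact h3⟩⟩,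
      ⟨hT, fun g hg => ⟨fun H => ?_, by rintro rfl; exact h5⟩⟩⟩
    · rcases key g hg (Or.inl H) with rfl | rfl
      · rfl
      · exact absurd H h6
    · rcases key g hg (Or.inr H) with rfl | rfl
      · exact absurd H h4
      · rfl
  by_cases h3 : Crosses s t S e
  · exact Or.inl (main S T key hS hT h1 h2 h3)
  · exact Or.inr (main T S (fun g hg H => key g hg H.symm) hT hS (iff_not_comm.1 h1)
      (iff_not_comm.1 h2) (not_not.1 (mt h1.2 h3)))

/-- Strict concavity of x(2n - x): the two cardinalities keep their sum but move further apart. -/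
lemma potential_inter_union (n : ℕ) {A B : Finset α} (hAB : ¬ A ⊆ B) (hBA : ¬ B ⊆ A) :
    ((A ∩ B).card : ℤ) * (2 * n - (A ∩ B).card) + (A ∪ B).card * (2 * n - (A ∪ B).card) <
      A.card * (2 * n - A.card) + B.card * (2 * n - B.card) := by
  have h1 : 0 < (A \ B).card := Finset.card_pos.2 (Finset.sdiff_nonempty.2 hAB)
  have h2 : 0 < (B \ A).card := Finset.card_pos.2 (Finset.sdiff_nonempty.2 hBA)
  have h3 := Finset.card_sdiff_add_card_inter A B
  have h4 := Finset.card_sdiff_add_card_inter B A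
  have h5 := Finset.card_union_add_card_inter A B
  rw [Finset.inter_comm B A] at h4
  have h6 : (A ∪ B).card = (A ∩ B).card + (A \ B).card + (B \ A).card := by omega
  rw [h6, ← h3, ← h4]
  push_cast
  have : (0 : ℤ) < (A \ B).card * (B \ A).card := by positivity
  nlinarith

/-- With n the number of vertices, x(2n - x) is strictly increasing on [0, n], and both sets shrink.
-/
lemma potential_sdiff [Fintype α] {A B : Finset α} (hAB : (A ∩ B).Nonempty) :
    ((A \ B).card : ℤ) * (2 * Fintype.card α - (A \ B).card) +
        (B \ A).card * (2 * Fintype.card α - (B \ A).card) <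
      A.card * (2 * Fintype.card α - A.card) + B.card * (2 * Fintype.card α - B.card) := by
  have h1 : 0 < (A ∩ B).card := Finset.card_pos.2 hAB
  have h3 := Finset.card_sdiff_add_card_inter A B
  have h4 := Finset.card_sdiff_add_card_inter B A
  have h5 := Finset.card_le_univ A
  have h6 := Finset.card_le_univ B
  rw [Finset.inter_comm B A] at h4
  rw [← h3] at h5 ⊢
  rw [← h4] at h6 ⊢
  generalize (A \ B).card = p at *
  generalize (B \ A).card = q at *
  generalize (A ∩ B).card = i at *
  generalize Fintype.card α = n at *
  zify at *
  nlinarith [mul_nonneg h1.le (sub_nonneg.2 h5), mul_nonneg h1.le (sub_nonneg.2 h6)]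

/-- A minimal cover of an uncrossable requirement has a laminar witness family. -/
lemma exists_laminar_witness [Finite α] [Finite β] (hh : Uncrossable h) (hc : Covers s t h F)
    (hF : ∀ e ∈ F, ¬ Covers s t h (F.erase e)) :
    ∃ W : β → Finset α, (∀ e ∈ F, IsWitness s t h F (W e) e) ∧
      ∀ e ∈ F, ∀ f ∈ F, Disjoint (W e) (W f) ∨ W e ⊆ W f ∨ W f ⊆ W e := by
  have := Fintype.ofFinite α
  choose! W₀ hW₀ using fun e (he : e ∈ F) => exists_witness hF hc he
  -- Both kinds of uncrossing strictly decrease this potential, so a witness family of least total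
  -- potential has no crossing pair.
  let pot : Finset α → ℤ := fun S => S.card * (2 * Fintype.card α - S.card)
  obtain ⟨W, hW, hmin⟩ := Set.exists_min_image
    {W : β → Finset α | ∀ e ∈ F, IsWitness s t h F (W e) e} (fun W => ∑ e ∈ F, pot (W e))
    (Set.toFinite _) ⟨W₀, hW₀⟩
  refine ⟨W, hW, fun e he f hf => ?_⟩
  by_contra hcon
  simp only [not_or, Finset.not_disjoint_iff_nonempty_inter] at hcon
  obtain ⟨hd, hef, hfe⟩ := hcon
  have hne : e ≠ f := by rintro rfl; exact hef subset_rfl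
  have improve : ∀ S T, IsWitness s t h F S e → IsWitness s t h F T f →
      pot S + pot T < pot (W e) + pot (W f) → False := by
    intro S T hS hT hlt
    have h1 := hmin (Function.update (Function.update W e S) f T) (by
      intro g hg
      by_cases h1 : g = f
      · subst h1; simpa using hT
      · by_cases h2 : g = e
        · subst h2; simpa [h1] using hS
        · simpa [h1, h2] using hW g hg)
    have he' : e ∈ F.erase f := Finset.mem_erase.2 ⟨hne, he⟩
    rw [← Finset.add_sum_erase F _ hf, ← Finset.add_sum_erase F _ hf,
      ← Finset.add_sum_erase _ _ he', ← Finset.add_sum_erase _ _ he'] at h1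
    have h2 : ∑ x ∈ (F.erase f).erase e, pot (Function.update (Function.update W e S) f T x) =
        ∑ x ∈ (F.erase f).erase e, pot (W x) := by
      refine Finset.sum_congr rfl fun x hx => ?_
      simp only [Finset.mem_erase] at hx
      rw [Function.update_of_ne hx.2.1, Function.update_of_ne hx.1]
    rw [h2, Function.update_self, Function.update_of_ne hne, Function.update_self] at h1
    linarith
  have e1 : Crosses s t (W e) e := ((hW e he).2 e he).2 rfl
  have f1 : Crosses s t (W f) f := ((hW f hf).2 f hf).2 rfl
  have e2 : ¬ Crosses s t (W f) e := fun H => hne (((hW f hf).2 e he).1 H)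
  have f2 : ¬ Crosses s t (W e) f := fun H => hne (((hW e he).2 f hf).1 H).symm
  rcases hh _ _ (hW e he).1 (hW f hf).1 with ⟨hS, hT⟩ | ⟨hS, hT⟩
  · have hpot := potential_inter_union (Fintype.card α) hef hfe
    have hf3 := f1.inter_iff_not_union f2
    rw [Finset.inter_comm, Finset.union_comm] at hf3
    rcases IsWitness.swap hc hf hne he (hW e he) (hW f hf) hS hT
      (fun g => Crosses.of_inter_or_union) (e1.inter_iff_not_union e2) hf3 with H | H
    · exact improve _ _ H.1 H.2 hpot
    · exact improve _ _ H.1 H.2 (by rw [add_comm]; exact hpot)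
  · have hpot := potential_sdiff hd
    have hf3 := f1.sdiff_iff_not_sdiff f2
    rcases IsWitness.swap hc hf hne he (hW e he) (hW f hf) hS hT
      (fun g => Crosses.of_sdiff) (e1.sdiff_iff_not_sdiff e2) (iff_not_comm.1 hf3) with H | H
    · exact improve _ _ H.1 H.2 hpot
    · exact improve _ _ H.1 H.2 (by rw [add_comm]; exact hpot)

end Uncrossable

section Uncrossable

open Classical

variable {α β : Type*} {s t : β → α} {h : Finset α → Prop} {F : Finset β}

/-! ### The number of edges of a minimal cover that leave minimal required sets -/

/-- Otherwise uncrossing yields `M ∩ S` or `M \ S` as a required proper subset of `M`. -/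
lemma Uncrossable.minimal_subset_or_disjoint (hh : Uncrossable h) {M S : Finset α}
    (hM : Minimal h M) (hS : h S) : M ⊆ S ∨ Disjoint M S := by
  by_contra hcon
  simp only [not_or, Finset.not_disjoint_iff_nonempty_inter] at hcon
  obtain ⟨hMS, hd⟩ := hcon
  rcases hh M S hM.prop hS with ⟨H, -⟩ | ⟨H, -⟩
  · exact hMS fun x hx => (Finset.mem_inter.1 (hM.le_of_le H Finset.inter_subset_left hx)).2
  · obtain ⟨x, hx⟩ := hd
    rw [Finset.mem_inter] at hx
    exact (Finset.mem_sdiff.1 (hM.le_of_le H Finset.sdiff_subset hx.1)).2 hx.2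

lemma Uncrossable.minimal_eq_of_mem (hh : Uncrossable h) {M N : Finset α}
    (hM : Minimal h M) (hN : Minimal h N) {x : α} (hxM : x ∈ M) (hxN : x ∈ N) : M = N := by
  rcases hh.minimal_subset_or_disjoint hM hN.prop with H | H
  · exact hN.eq_of_le hM.prop H
  · exact absurd hxN (Finset.disjoint_left.1 H hxM)

lemma Covers.nonempty (hc : Covers s t h F) {S : Finset α} (hS : h S) : S.Nonempty := by
  obtain ⟨e, -, he⟩ := hc S hS
  by_contra H
  rw [Finset.not_nonempty_iff_eq_empty] at H
  subst H
  simp [Crosses] at he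

/-- An edge that crosses both of the disjoint sets `S` and `T` has an end in each of them. -/
lemma Crosses.exists_ends {S T : Finset α} {e : β} (hST : Disjoint S T) (hS : Crosses s t S e)
    (hT : Crosses s t T e) : ∃ u v, u ∈ S ∧ v ∈ T ∧ ∀ U, Crosses s t U e ↔ ¬ (u ∈ U ↔ v ∈ U) := by
  have h1 : ∀ x ∈ S, x ∉ T := fun x hx => Finset.disjoint_left.1 hST hx
  by_cases hs : s e ∈ S
  · refine ⟨s e, t e, hs, ?_, fun U => Iff.rfl⟩
    by_contra H
    exact hT (iff_of_false (h1 _ hs) H)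
  · have ht : t e ∈ S := by
      by_contra H
      exact hS (iff_of_false hs H)
    refine ⟨t e, s e, ht, ?_, fun U => not_congr Iff.comm⟩
    by_contra H
    exact hT (iff_of_false H (h1 _ ht))

/-- The average number of edges of a minimal cover leaving a minimal required set is at most `2`. -/
theorem sum_card_minimal_crossed_le [Fintype α] [Finite β] (hh : Uncrossable h)
    (hc : Covers s t h F) (hF : ∀ e ∈ F, ¬ Covers s t h (F.erase e)) :
    ∑ e ∈ F, (Finset.univ.filter fun M => Minimal h M ∧ Crosses s t M e).card ≤
      2 * (Finset.univ.filter fun M => Minimal h M).card := by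
  obtain ⟨W, hW, hlam⟩ := exists_laminar_witness hh hc hF
  set MM : Finset (Finset α) := Finset.univ.filter fun M => Minimal h M with hMM
  have memMM : ∀ M, M ∈ MM ↔ Minimal h M := by simp [hMM]
  have dich : ∀ M ∈ MM, ∀ e ∈ F, M ⊆ W e ∨ Disjoint M (W e) := fun M hM e he =>
    hh.minimal_subset_or_disjoint ((memMM M).1 hM) (hW e he).1
  have cross_self : ∀ e ∈ F, Crosses s t (W e) e := fun e he => ((hW e he).2 e he).2 rfl
  have cross_eq : ∀ e ∈ F, ∀ f ∈ F, Crosses s t (W e) f → f = e :=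
    fun e he f hf => ((hW e he).2 f hf).1
  have neMM : ∀ M ∈ MM, M.Nonempty := fun M hM => hc.nonempty ((memMM M).1 hM).prop
  have neW : ∀ e ∈ F, (W e).Nonempty := fun e he => hc.nonempty (hW e he).1
  have nested : ∀ M ∈ MM, ∀ e ∈ F, ∀ f ∈ F, M ⊆ W e → M ⊆ W f → W e ⊆ W f ∨ W f ⊆ W e := by
    intro M hM e he f hf h1 h2
    refine (hlam e he f hf).resolve_left fun hd => ?_
    obtain ⟨x, hx⟩ := neMM M hM
    exact Finset.disjoint_left.1 hd (h1 hx) (h2 hx)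
  -- Pairs of an edge and a minimal set that it leaves are split according to whether the set lies
  -- inside the witness of the edge or is disjoint from it. Each kind is bounded by the number of
  -- minimal sets.
  set inner := (F ×ˢ MM).filter fun p => Crosses s t p.2 p.1 ∧ p.2 ⊆ W p.1 with hinner
  set outer := (F ×ˢ MM).filter fun p => Crosses s t p.2 p.1 ∧ Disjoint p.2 (W p.1) with houter
  have hsum : ∑ e ∈ F, (Finset.univ.filter fun M => Minimal h M ∧ Crosses s t M e).card ≤
      inner.card + outer.card := by
    have h1 : ∑ e ∈ F, (Finset.univ.filter fun M => Minimal h M ∧ Crosses s t M e).card =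
        ((F ×ˢ MM).filter fun p => Crosses s t p.2 p.1).card := by
      rw [Finset.card_filter, Finset.sum_product]
      refine Finset.sum_congr rfl fun e _ => ?_
      rw [← Finset.card_filter, hMM, Finset.filter_filter]
    rw [h1]
    refine le_trans (Finset.card_le_card ?_) (Finset.card_union_le _ _)
    intro p hp
    simp only [hinner, houter, Finset.mem_union, Finset.mem_filter, Finset.mem_product] at hp ⊢
    rcases dich p.2 hp.1.2 p.1 hp.1.1 with H | H
    · exact Or.inl ⟨hp.1, hp.2, H⟩
    · exact Or.inr ⟨hp.1, hp.2, H⟩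
  -- an edge that leaves `M ⊆ W e` and `W f ⊇ W e` is `e`
  have inner_aux : ∀ M ∈ MM, ∀ e ∈ F, ∀ f ∈ F, M ⊆ W e → W e ⊆ W f → Crosses s t M f → f = e := by
    intro M hM e he f hf hMe hef hcr
    refine cross_eq e he f hf ?_
    have h1 := cross_self f hf
    simp only [Crosses] at hcr h1 ⊢
    have a1 := fun x (hx : x ∈ M) => hMe hx
    have a2 := fun x (hx : x ∈ W e) => hef hx
    have b1 := a1 (s f)
    have b2 := a1 (t f)
    have b3 := a2 (s f)
    have b4 := a2 (t f)
    clear a1 a2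
    tauto
  have hin : inner.card ≤ MM.card := by
    refine Finset.card_le_card_of_injOn Prod.snd (fun p hp => ?_) ?_
    · simp only [hinner, Finset.coe_filter, Finset.mem_product, Set.mem_ofPred_eq] at hp
      exact hp.1.2
    · rintro ⟨e, M⟩ hp ⟨f, N⟩ hq (rfl : M = N)
      simp only [hinner, Finset.coe_filter, Finset.mem_product, Set.mem_ofPred_eq] at hp hq
      obtain ⟨⟨he, hM⟩, hce, hMe⟩ := hp
      obtain ⟨⟨hf, -⟩, hcf, hMf⟩ := hq
      rcases nested M hM e he f hf hMe hMf with H | H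
      · rw [inner_aux M hM e he f hf hMe H hcf]
      · rw [inner_aux M hM f hf e he hMf H hce]
  set Out := F.filter fun e => ∃ M ∈ MM, Crosses s t M e ∧ Disjoint M (W e) with hOut
  have hout1 : outer.card ≤ Out.card := by
    refine Finset.card_le_card_of_injOn Prod.fst (fun p hp => ?_) ?_
    · simp only [houter, hOut, Finset.coe_filter, Finset.mem_product, Set.mem_ofPred_eq] at hp ⊢
      exact ⟨hp.1.1, p.2, hp.1.2, hp.2⟩
    · rintro ⟨e, M⟩ hp ⟨f, N⟩ hq (rfl : e = f)
      simp only [houter, Finset.coe_filter, Finset.mem_product, Set.mem_ofPred_eq] at hp hq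
      obtain ⟨⟨he, hM⟩, hcM, hdM⟩ := hp
      obtain ⟨⟨-, hN⟩, hcN, hdN⟩ := hq
      obtain ⟨u, v, hu, hv, huv⟩ := Crosses.exists_ends hdM.symm (cross_self e he) hcM
      have huN : u ∉ N := Finset.disjoint_right.1 hdN hu
      have hvN : v ∈ N := by
        rw [huv] at hcN
        by_contra H
        exact hcN (iff_of_false huN H)
      rw [hh.minimal_eq_of_mem ((memMM M).1 hM) ((memMM N).1 hN) hv hvN]
  -- Each edge of `Out` gets a minimal set of its own: one inside its witness but in no smaller
  -- witness of `Out`. If smaller witnesses exist, take a largest one, `W f`. The minimal set that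
  -- `f` enters outside `W f` works, because `f` cannot cross the witness of another edge.
  have hphi : ∀ e ∈ Out, ∃ M ∈ MM, M ⊆ W e ∧ ∀ f ∈ Out, f ≠ e → W f ⊆ W e → ¬ M ⊆ W f := by
    intro e he
    have heF : e ∈ F := (Finset.mem_filter.1 he).1
    by_cases hex : (Out.filter fun f => f ≠ e ∧ W f ⊆ W e).Nonempty
    · obtain ⟨f, hf, hmax⟩ := Finset.exists_max_image _ (fun f => (W f).card) hex
      simp only [Finset.mem_filter] at hf hmax
      obtain ⟨hfO, hfe, hsub⟩ := hf
      obtain ⟨hfF, M, hM, hcM, hdM⟩ := Finset.mem_filter.1 hfO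
      obtain ⟨u, v, hu, hv, huv⟩ := Crosses.exists_ends hdM.symm (cross_self f hfF) hcM
      have hvf : v ∉ W f := Finset.disjoint_left.1 hdM hv
      have hve : v ∈ W e := by
        by_contra H
        exact hfe (cross_eq e heF f hfF ((huv _).2 fun h' => H (h'.1 (hsub hu))))
      refine ⟨M, hM, (dich M hM e heF).resolve_right fun H => Finset.disjoint_left.1 H hv hve, ?_⟩
      intro g hg hge hgsub hMg
      have hgF : g ∈ F := (Finset.mem_filter.1 hg).1
      have hfg : f ≠ g := by
        rintro rfl
        exact hvf (hMg hv)
      have hug : u ∈ W g := by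
        by_contra H
        exact hfg (cross_eq g hgF f hfF ((huv _).2 fun h' => H (h'.2 (hMg hv))))
      rcases hlam f hfF g hgF with H | H | H
      · exact Finset.disjoint_left.1 H hu hug
      · have hss : W f ⊂ W g := ⟨H, fun H' => hvf (H' (hMg hv))⟩
        exact absurd (hmax g ⟨hg, hge, hgsub⟩) (not_le.2 (Finset.card_lt_card hss))
      · exact hvf (H (hMg hv))
    · obtain ⟨M, hMle, hM⟩ := (Set.toFinite {S | h S}).exists_le_minimal (hW e heF).1
      refine ⟨M, (memMM M).2 hM, hMle, fun f hf hfe hsub => ?_⟩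
      exact absurd ⟨f, Finset.mem_filter.2 ⟨hf, hfe, hsub⟩⟩ hex
  have hout2 : Out.card ≤ MM.card := by
    choose! φ hφ using hphi
    refine Finset.card_le_card_of_injOn φ (fun e he => (hφ e he).1) fun e he f hf hef => ?_
    obtain ⟨h1, h2, h3⟩ := hφ e he
    obtain ⟨h4, h5, h6⟩ := hφ f hf
    by_contra hne
    rcases nested _ h1 e (Finset.mem_filter.1 he).1 f (Finset.mem_filter.1 hf).1 h2
      (by rw [hef]; exact h5) with H | H
    · exact h6 e he hne H (by rw [← hef]; exact h2)
    · exact h3 f hf (Ne.symm hne) H (by rw [hef]; exact h5)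
  omega

/-- The integrality gap of the covering problem of an uncrossable requirement is at most `2`. -/
theorem Uncrossable.exists_cover [Finite α] [Finite β] (X : Finset β) (hh : Uncrossable h)
    (hX : Covers s t h X) (c y : β → ℝ) (hc : ∀ e ∈ X, 0 ≤ c e) (hy : ∀ e, 0 ≤ y e)
    (hcov : ∀ S, h S → 1 ≤ ∑ e ∈ X with Crosses s t S e, y e) :
    ∃ F ⊆ X, Covers s t h F ∧ (∀ e ∈ F, ¬ Covers s t h (F.erase e)) ∧
      ∑ e ∈ F, c e ≤ 2 * ∑ e ∈ X, c e * y e := by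
  have := Fintype.ofFinite α
  induction hn : X.card generalizing X h c with
  | zero =>
    rw [Finset.card_eq_zero] at hn
    subst hn
    exact ⟨∅, subset_rfl, hX, by simp, by simp⟩
  | succ n ih =>
    -- A free edge `z` is contracted: cover the sets it does not cross without using it, and put it
    -- back only if the result fails to cover `h`. This preserves minimality.
    have zero_case : ∀ c : β → ℝ, (∀ e ∈ X, 0 ≤ c e) → (∃ z ∈ X, c z = 0) →
        ∃ F ⊆ X, Covers s t h F ∧ (∀ e ∈ F, ¬ Covers s t h (F.erase e)) ∧
          ∑ e ∈ F, c e ≤ 2 * ∑ e ∈ X, c e * y e := by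
      rintro c hc ⟨z, hz, hcz⟩
      obtain ⟨F, hFX, hFc, hFm, hFw⟩ := ih (h := fun S => h S ∧ ¬ Crosses s t S z) (X.erase z)
        (hh.and_not_crosses z)
        (fun S hS => by
          obtain ⟨e, he, hcr⟩ := hX S hS.1
          exact ⟨e, Finset.mem_erase.2 ⟨fun H => hS.2 (H ▸ hcr), he⟩, hcr⟩)
        c (fun e he => hc e (Finset.mem_of_mem_erase he))
        (fun S hS => by
          have h1 := hcov S hS.1
          rwa [Finset.filter_erase, Finset.erase_eq_of_notMem]
          simp [hS.2])
        (by rw [Finset.card_erase_of_mem hz, hn]; rfl)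
      have hcost : ∑ e ∈ X.erase z, c e * y e = ∑ e ∈ X, c e * y e := by
        rw [← Finset.add_sum_erase X _ hz, hcz]; simp
      rw [hcost] at hFw
      have hzF : z ∉ F := fun H => (Finset.mem_erase.1 (hFX H)).1 rfl
      have hFX' : F ⊆ X := hFX.trans (Finset.erase_subset _ _)
      by_cases hF : Covers s t h F
      · exact ⟨F, hFX', hF, fun e he H => hFm e he fun S hS => H S hS.1, hFw⟩
      · refine ⟨insert z F, Finset.insert_subset hz hFX', fun S hS => ?_, fun e he H => ?_, ?_⟩
        · by_cases hcr : Crosses s t S z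
          · exact ⟨z, Finset.mem_insert_self _ _, hcr⟩
          · obtain ⟨e, he, hce⟩ := hFc S ⟨hS, hcr⟩
            exact ⟨e, Finset.mem_insert_of_mem he, hce⟩
        · rcases Finset.mem_insert.1 he with rfl | heF
          · rw [Finset.erase_insert hzF] at H
            exact hF H
          · refine hFm e heF fun S hS => ?_
            obtain ⟨f, hf, hcf⟩ := H S hS.1
            rw [Finset.mem_erase, Finset.mem_insert] at hf
            refine ⟨f, Finset.mem_erase.2 ⟨hf.1, hf.2.resolve_left ?_⟩, hcf⟩
            rintro rfl
            exact hS.2 hcf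
        · rw [Finset.sum_insert hzF, hcz, zero_add]
          exact hFw
    by_cases hemp : ∃ S, h S
    swap
    · refine ⟨∅, Finset.empty_subset _, fun S hS => absurd ⟨S, hS⟩ hemp, by simp, ?_⟩
      rw [Finset.sum_empty]
      exact mul_nonneg zero_le_two (Finset.sum_nonneg fun e he => mul_nonneg (hc e he) (hy e))
    -- Local ratio: under the cost `w`, every minimal cover costs at most `2 * k` and every
    -- fractional cover at least `k`, where `k` is the number of minimal required sets.
    set w : β → ℝ :=
      fun e => (Finset.univ.filter fun M => Minimal h M ∧ Crosses s t M e).card with hw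
    have hw0 : ∀ e, 0 ≤ w e := fun e => Nat.cast_nonneg _
    obtain ⟨S, hS⟩ := hemp
    obtain ⟨M, -, hM⟩ := (Set.toFinite {S | h S}).exists_le_minimal hS
    have hpos : (X.filter fun e => 0 < w e).Nonempty := by
      obtain ⟨e, he, hce⟩ := hX M hM.prop
      refine ⟨e, Finset.mem_filter.2 ⟨he, ?_⟩⟩
      exact Nat.cast_pos.2 <| Finset.card_pos.2 ⟨M, Finset.mem_filter.2 ⟨Finset.mem_univ _, hM, hce⟩⟩
    obtain ⟨z, hz, hmin⟩ := Finset.exists_min_image _ (fun e => c e / w e) hpos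
    rw [Finset.mem_filter] at hz
    -- The largest multiple of `w` that can be subtracted with costs staying nonnegative; it makes
    -- `z` free.
    set ε := c z / w z with hε
    have hε0 : 0 ≤ ε := div_nonneg (hc z hz.1) (hw0 z)
    obtain ⟨F, hFX, hFc, hFm, hFw⟩ := zero_case (fun e => c e - ε * w e)
      (fun e he => by
        rcases (hw0 e).eq_or_lt with H | H
        · simp [← H, hc e he]
        · have := hmin e (Finset.mem_filter.2 ⟨he, H⟩)
          rw [le_div_iff₀ H] at this
          exact sub_nonneg.2 this)
      ⟨z, hz.1, by rw [hε, div_mul_cancel₀ _ hz.2.ne', sub_self]⟩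
    refine ⟨F, hFX, hFc, hFm, ?_⟩
    set k : ℝ := ((Finset.univ.filter fun M => Minimal h M).card : ℝ) with hk
    have h1 : ∑ e ∈ F, w e ≤ 2 * k := by
      have := sum_card_minimal_crossed_le hh hFc hFm
      simp only [hw, hk]
      exact_mod_cast this
    have h2 : k ≤ ∑ e ∈ X, w e * y e := by
      have h3 : ∑ e ∈ X, w e * y e =
          ∑ M ∈ Finset.univ.filter fun M => Minimal h M, ∑ e ∈ X with Crosses s t M e, y e := by
        simp only [hw, Finset.card_filter, Finset.sum_filter, Nat.cast_sum, Finset.sum_mul]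
        rw [Finset.sum_comm]
        refine Finset.sum_congr rfl fun M _ => ?_
        by_cases hM : Minimal h M <;> simp [hM]
      rw [h3, hk, ← nsmul_one, ← Finset.sum_const]
      exact Finset.sum_le_sum fun M hM => hcov M (Finset.mem_filter.1 hM).2.prop
    simp only [sub_mul, Finset.sum_sub_distrib, mul_assoc, ← Finset.mul_sum] at hFw
    have h5 := mul_le_mul_of_nonneg_left (h1.trans (mul_le_mul_of_nonneg_left h2 zero_le_two)) hε0
    linarith

end Uncrossable

/-! ### The upper bound for `D`-cuts. -/

section Cuts

open Classical Relation

/-! ### Covering problems of equivalent families -/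

/-- As `y ≥ 0`, the constraint of a set follows from that of any subset. Used in both directions,
this identifies covering problems of different families. -/
lemma coverFeasible_subset {β : Type*} {F G : Set (Finset β)} (h : ∀ C ∈ G, ∃ C' ∈ F, C' ⊆ C) :
    coverFeasible F ⊆ coverFeasible G := by
  rintro y ⟨hy, hy0⟩
  refine ⟨fun C hC => ?_, hy0⟩
  obtain ⟨C', hC', hsub⟩ := h C hC
  exact (hy C' hC').trans (Finset.sum_le_sum_of_subset_of_nonneg hsub fun e _ _ => hy0 e)

lemma lpValue_congr {β : Type*} [Fintype β] {F G : Set (Finset β)}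
    (h : coverFeasible F = coverFeasible G) : lpValue F = lpValue G := by
  rw [lpValue, lpValue, h]

lemma ipValue_congr {β : Type*} [Fintype β] {F G : Set (Finset β)}
    (h : coverFeasible F = coverFeasible G) : ipValue F = ipValue G := by
  rw [ipValue, ipValue, h]

/-- The cuts `δ(U)`, of the graph in which `e` has the ends `s e` and `t e`, that contain exactly
one edge of `D`. -/
def demandCuts {α β : Type*} (s t : β → α) (D : Set β) : Set (Finset β) :=
  {C | (∃ U : Set α, ∀ e, e ∈ C ↔ ¬(s e ∈ U ↔ t e ∈ U)) ∧ ∃! e, e ∈ C ∧ e ∈ D}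

lemma card_eq_one_iff_existsUnique {β : Type*} {S : Finset β} : S.card = 1 ↔ ∃! e, e ∈ S := by
  rw [Finset.card_eq_one]
  constructor
  · rintro ⟨a, rfl⟩
    exact ⟨a, by simp, by simp⟩
  · rintro ⟨a, ha, hu⟩
    exact ⟨a, Finset.eq_singleton_iff_unique_mem.2 ⟨ha, hu⟩⟩

theorem ipValue_demandCuts_le {α β : Type*} [Finite α] [Fintype β] (s t : β → α) (D : Set β) :
    ipValue (demandCuts s t D) ≤ 2 * lpValue (demandCuts s t D) := by
  have := Fintype.ofFinite α
  rw [mul_comm, ← ENNReal.div_le_iff_le_mul (by simp) (by simp)]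
  refine le_iInf₂ fun y hy => ?_
  refine ENNReal.div_le_of_le_mul ?_
  set h : Finset α → Prop :=
    fun S => ((Finset.univ.filter (· ∈ D)).filter (Crosses s t S)).card = 1 with hh
  have hmem : ∀ S, h S → Finset.univ.filter (Crosses s t S) ∈ demandCuts s t D := by
    intro S hS
    refine ⟨⟨S, fun e => by simp [Crosses]⟩, ?_⟩
    have h1 := card_eq_one_iff_existsUnique.1 hS
    simpa [and_comm] using h1
  obtain ⟨F, -, hF, -, hcost⟩ := (uncrossable_card_eq_one s t (Finset.univ.filter (· ∈ D))).exists_cover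
    Finset.univ (fun S hS => by
      obtain ⟨e, he, -⟩ := card_eq_one_iff_existsUnique.1 hS
      exact ⟨e, Finset.mem_univ _, (Finset.mem_filter.1 he).2⟩)
    (fun _ => 1) y (fun _ _ => zero_le_one) hy.2 (fun S hS => hy.1 _ (hmem S hS))
  simp only [Finset.sum_const, nsmul_eq_mul, mul_one, one_mul] at hcost
  have hfeas : (fun e => if e ∈ F then (1 : ℝ) else 0) ∈
      coverFeasible (demandCuts s t D) ∩ integral β := by
    refine ⟨⟨fun C hC => ?_, fun e => by positivity⟩, fun e => ?_⟩
    · obtain ⟨⟨U, hU⟩, e₀, he₀, hu⟩ := hC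
      have hcr : ∀ e, Crosses s t U.toFinite.toFinset e ↔ e ∈ C := fun e => by
        simp [Crosses, hU]
      obtain ⟨e, heF, he⟩ := hF U.toFinite.toFinset (by
        simp only [card_eq_one_iff_existsUnique, Finset.mem_filter, hcr, Finset.mem_univ, true_and]
        exact ⟨e₀, he₀.symm, fun e he => hu e he.symm⟩)
      refine le_trans ?_ (Finset.single_le_sum (fun e _ => by positivity) ((hcr e).1 he))
      simp [heF]
    · by_cases he : e ∈ F
      · exact ⟨1, by simp [he]⟩
      · exact ⟨0, by simp [he]⟩
  refine (iInf₂_le _ hfeas).trans ?_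
  have h2 : (2 : ℝ≥0∞) = ENNReal.ofReal 2 := by simp
  rw [h2, ← ENNReal.ofReal_mul (Finset.sum_nonneg fun e _ => hy.2 e), mul_comm]
  refine ENNReal.ofReal_le_ofReal ?_
  simpa using hcost

/-! ### Simple cuts -/

variable {α β : Type*} {G : Graph α β}

lemma mem_cut_iff {s t : β → α} (h : ∀ e, G.IsLink e (s e) (t e)) (U : Set α) (e : β) :
    e ∈ cut G U ↔ ¬(s e ∈ U ↔ t e ∈ U) := by
  constructor
  · rintro ⟨x, y, hxy, hx, hy⟩
    rcases hxy.eq_and_eq_or_eq_and_eq (h e) with ⟨rfl, rfl⟩ | ⟨rfl, rfl⟩ <;> tauto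
  · intro H
    by_cases hs : s e ∈ U
    · exact ⟨_, _, h e, hs, by tauto⟩
    · exact ⟨_, _, (h e).symm, by tauto, hs⟩

/-- The vertex set of the component of `x` in the subgraph induced by `U`. -/
def component (G : Graph α β) (U : Set α) (x : α) : Set α :=
  {y | ReflTransGen (G.induce U).Adj x y}

lemma adj_induce {U : Set α} {x y : α} :
    (G.induce U).Adj x y ↔ G.Adj x y ∧ x ∈ U ∧ y ∈ U := by
  simp [Graph.Adj, Graph.induce]

lemma component_subset {U : Set α} {x : α} (hx : x ∈ U) : component G U x ⊆ U := by
  intro y hy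
  rcases hy.cases_tail with rfl | ⟨z, -, hz⟩
  · exact hx
  · exact (adj_induce.1 hz).2.2

lemma reflTransGen_adj_symm {x y : α} (h : ReflTransGen G.Adj x y) : ReflTransGen G.Adj y x := by
  have : Std.Symm G.Adj := ⟨fun _ _ => Graph.Adj.symm⟩
  exact ReflTransGen.stdSymm.symm _ _ h

lemma reflTransGen_induce_component {U : Set α} {x y : α} (hy : y ∈ component G U x) :
    ReflTransGen (G.induce (component G U x)).Adj x y := by
  change ReflTransGen (G.induce U).Adj x y at hy
  induction hy with
  | refl => exact .refl
  | tail hab hbc ih =>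
    exact ih.tail (adj_induce.2 ⟨(adj_induce.1 hbc).1, hab, hab.tail hbc⟩)

lemma isConnected_of_forall_reach {U : Set α} {x : α} (hx : x ∈ U)
    (h : ∀ y ∈ U, ReflTransGen (G.induce U).Adj x y) : IsConnected (G.induce U) :=
  ⟨⟨x, hx⟩, fun y hy z hz => (reflTransGen_adj_symm (h y hy)).trans (h z hz)⟩

lemma component_connected {U : Set α} {x : α} :
    IsConnected (G.induce (component G U x)) :=
  isConnected_of_forall_reach ReflTransGen.refl fun _ => reflTransGen_induce_component

lemma cut_component_subset {U : Set α} {x : α} (hx : x ∈ U) :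
    cut G (component G U x) ⊆ cut G U := by
  rintro e ⟨a, b, hab, ha, hb⟩
  refine ⟨a, b, hab, component_subset hx ha, fun hbU => hb ?_⟩
  exact ReflTransGen.tail ha (adj_induce.2 ⟨hab.adj, component_subset hx ha, hbU⟩)

lemma cut_compl (U : Set α) : cut G Uᶜ = cut G U := by
  ext e
  constructor
  · rintro ⟨x, y, hxy, hx, hy⟩
    exact ⟨y, x, hxy.symm, not_not.1 hy, hx⟩
  · rintro ⟨x, y, hxy, hx, hy⟩
    exact ⟨y, x, hxy.symm, hy, not_not.2 hx⟩

/-- Every edge of a cut of a connected graph lies in a simple cut contained in the given one. -/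
lemma exists_simpleCut (hV : V(G) = Set.univ) (hG : IsConnected G) {U : Set α} {d : β}
    (hd : d ∈ cut G U) : ∃ C, IsSimpleCut G C ∧ d ∈ C ∧ C ⊆ cut G U := by
  obtain ⟨x, y, hxy, hx, hy⟩ := hd
  set A := component G U x with hA
  have hyA : y ∈ Aᶜ := fun h => hy (component_subset hx h)
  have hxA : x ∈ A := ReflTransGen.refl
  set B := component G Aᶜ y with hB
  have hyB : y ∈ B := ReflTransGen.refl
  have hBA : B ⊆ Aᶜ := component_subset hyA
  have hAB : A ⊆ Bᶜ := fun z hz hzB => hBA hzB hz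
  refine ⟨cut G B, ⟨B, by simp [hV], component_connected, ?_, rfl⟩,
    ⟨y, x, hxy.symm, hyB, fun h => hBA h hxA⟩, ?_⟩
  · rw [hV, ← Set.compl_eq_univ_sdiff]
    have inA : ∀ z ∈ A, ReflTransGen (G.induce Bᶜ).Adj x z := fun z hz =>
      ReflTransGen.lift id (fun a b hab =>
        have hab := adj_induce.1 hab
        adj_induce.2 ⟨hab.1, hAB hab.2.1, hAB hab.2.2⟩) _ _ (reflTransGen_induce_component hz)
    -- Follow a walk from `x` in `G`. Whenever it leaves `B` it enters `A`, since `B` is a component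
    -- of the complement of `A`; and `A` is connected and avoids `B`, so a walk from `x` inside `A`
    -- can replace what came before.
    refine isConnected_of_forall_reach (hAB hxA) fun z hz => ?_
    have hxz : ReflTransGen G.Adj x z := hG.2 x (by simp [hV]) z (by simp [hV])
    clear_value B
    induction hxz with
    | refl => exact .refl
    | @tail w z _ hwz ih =>
      by_cases hw : w ∈ B
      · refine inA z (by_contra fun hzA => hz ?_)
        rw [hB]
        exact ReflTransGen.tail (hB ▸ hw : w ∈ component G Aᶜ y)
          (adj_induce.2 ⟨hwz, hBA hw, hzA⟩)
      · exact (ih hw).tail (adj_induce.2 ⟨hwz, hw, hz⟩)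
  · calc cut G B ⊆ cut G Aᶜ := cut_component_subset hyA
      _ = cut G A := cut_compl A
      _ ⊆ cut G U := cut_component_subset hx

/-- A simple cut through the only demand edge of a cut and contained in that cut is a `D`-cut.
Dropping simplicity is what makes the requirement uncrossable. -/
theorem coverFeasible_dCuts (I : Inst) {s t : I.Edge → I.Vert}
    (h : ∀ e, I.graph.IsLink e (s e) (t e)) :
    coverFeasible (dCuts I) = coverFeasible (demandCuts s t I.demand) := by
  refine Set.Subset.antisymm (coverFeasible_subset ?_) (coverFeasible_subset ?_)
  · rintro C ⟨⟨U, hU⟩, d, ⟨hdC, hdD⟩, hu⟩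
    obtain ⟨C', hC', hd, hsub⟩ := exists_simpleCut I.vertexSet_eq I.connected (U := U) (d := d)
      ((mem_cut_iff h U d).2 ((hU d).1 hdC))
    have hC'C : C'.toFinite.toFinset ⊆ C := by
      intro e he
      exact (hU e).2 ((mem_cut_iff h U e).1 (hsub (by simpa using he)))
    refine ⟨C'.toFinite.toFinset, ⟨by simpa using hC', d, ⟨by simpa using hd, hdD⟩,
      fun e he => hu e ⟨hC'C he.1, he.2⟩⟩, hC'C⟩
  · rintro C ⟨⟨U, -, -, -, hC⟩, hu⟩
    refine ⟨C, ⟨⟨U, fun e => ?_⟩, hu⟩, subset_rfl⟩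
    rw [← mem_cut_iff h, ← hC, Finset.mem_coe]

lemma Inst.exists_ends (I : Inst) :
    ∃ s t : I.Edge → I.Vert, ∀ e, I.graph.IsLink e (s e) (t e) := by
  have h : ∀ e, ∃ x y, I.graph.IsLink e x y := fun e =>
    I.graph.exists_isLink_of_mem_edgeSet (by simp [I.edgeSet_eq])
  choose s t h using h
  exact ⟨s, t, h⟩

theorem integralityGap_dCuts_le : integralityGap (fun _ => True) dCuts ≤ 2 := by
  refine iSup₂_le fun I _ => ENNReal.div_le_of_le_mul ?_
  obtain ⟨s, t, h⟩ := I.exists_ends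
  rw [lpValue_congr (coverFeasible_dCuts I h), ipValue_congr (coverFeasible_dCuts I h)]
  exact ipValue_demandCuts_le s t I.demand

end Cuts

/-! ### Cycles, face boundaries and Euler's formula over `ZMod 2`. -/

section Cycles

open Classical Relation

variable {α β Φ : Type*}

/-! ### Even edge sets contain cycles -/

/-- Incidence of the edge `e` and the vertex `x` modulo `2`. -/
noncomputable def inc (s t : β → α) : Matrix β α (ZMod 2) :=
  fun e x => (if s e = x then 1 else 0) + (if t e = x then 1 else 0)

lemma sum_inc_mul [Fintype α] (s t : β → α) (u : α → ZMod 2) (e : β) :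
    ∑ x, inc s t e x * u x = u (s e) + u (t e) := by
  simp [inc, add_mul, Finset.sum_add_distrib]

lemma inc_congr {G : Graph α β} {s t : β → α} (h : ∀ e, G.IsLink e (s e) (t e)) {e : β} {x y : α}
    (hxy : G.IsLink e x y) (z : α) :
    inc s t e z = (if x = z then 1 else 0) + (if y = z then 1 else 0) := by
  rcases (h e).eq_and_eq_or_eq_and_eq hxy with ⟨h1, h2⟩ | ⟨h1, h2⟩
  · simp [inc, h1, h2]
  · simp [inc, h1, h2, add_comm]

/-- A path in a graph whose edges come from `Z`, closed by the edge `d`, is a cycle. -/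
lemma exists_cycle_of_reachable {G : Graph α β} {Z : Set β} {H : SimpleGraph α}
    (hH : ∀ x y, H.Adj x y → ∃ e ∈ Z, G.IsLink e x y) {d : β} (hd : d ∉ Z) {x y : α}
    (hxy : G.IsLink d x y) (hr : H.Reachable y x) :
    ∃ C, IsCycle G C ∧ d ∈ C ∧ C ⊆ insert d Z := by
  obtain ⟨p, hp⟩ := hr.exists_isPath
  have hadj : ∀ i, ∃ e, i < p.length → e ∈ Z ∧ G.IsLink e (p.getVert i) (p.getVert (i + 1)) := by
    intro i
    by_cases hi : i < p.length
    · obtain ⟨e, he⟩ := hH _ _ (p.adj_getVert_succ hi)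
      exact ⟨e, fun _ => he⟩
    · exact ⟨d, fun h => absurd h hi⟩
  choose ed hed using hadj
  have vinj : ∀ i j, i ≤ p.length → j ≤ p.length → p.getVert i = p.getVert j → i = j :=
    fun i j hi hj hij => hp.getVert_injOn hi hj hij
  have einj : ∀ i j, i < p.length → j < p.length → ed i = ed j → i = j := by
    intro i j hi hj hij
    have h1 := (hed i hi).2
    rw [hij] at h1
    rcases h1.eq_and_eq_or_eq_and_eq (hed j hj).2 with ⟨h2, -⟩ | ⟨h2, h3⟩
    · exact vinj _ _ hi.le hj.le h2
    · have h4 := vinj _ _ hi.le hj h2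
      have h5 := vinj _ _ hi hj.le h3
      omega
  refine ⟨Set.range fun i : Fin (p.length + 1) => if (i : ℕ) < p.length then ed i else d,
    ⟨p.length, fun i => p.getVert i, _, ?_, ?_, rfl, ?_⟩, ⟨Fin.last _, by simp⟩, ?_⟩
  · intro i j hij
    exact Fin.ext (vinj _ _ (Nat.lt_succ_iff.1 i.2) (Nat.lt_succ_iff.1 j.2) hij)
  · intro i j hij
    have hi := i.2
    have hj := j.2
    apply Fin.ext
    by_cases h1 : (i : ℕ) < p.length <;> by_cases h2 : (j : ℕ) < p.length
    · simp only [h1, h2, if_true] at hij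
      exact einj _ _ h1 h2 hij
    · simp only [h1, h2, if_true, if_false] at hij
      exact absurd (hij ▸ (hed i h1).1) hd
    · simp only [h1, h2, if_true, if_false] at hij
      exact absurd (hij ▸ (hed j h2).1) hd
    · omega
  · intro i
    refine Fin.lastCases ?_ (fun j => ?_) i
    · simpa using hxy
    · have := (hed j j.2).2
      simpa [Fin.val_add_one_of_lt (Fin.castSucc_lt_last j)] using this
  · rintro _ ⟨i, rfl⟩
    by_cases h1 : (i : ℕ) < p.length
    · simp only [h1, if_true]
      exact Set.mem_insert_of_mem _ (hed i h1).1
    · simp [h1]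

/-- An edge set in which all degrees are even contains a cycle through each of its edges. -/
lemma exists_cycle_of_even [Fintype α] {G : Graph α β} {s t : β → α}
    (h : ∀ e, G.IsLink e (s e) (t e)) (Z : Finset β) (hZ : ∀ x, ∑ e ∈ Z, inc s t e x = 0) {d : β}
    (hd : d ∈ Z) : ∃ C, IsCycle G C ∧ d ∈ C ∧ C ⊆ Z := by
  let H : SimpleGraph α :=
    { Adj := fun x y => x ≠ y ∧ ∃ e ∈ Z.erase d, G.IsLink e x y
      symm := ⟨fun x y ⟨hne, e, he, hl⟩ => ⟨hne.symm, e, he, hl.symm⟩⟩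
      loopless := ⟨fun x hx => hx.1 rfl⟩ }
  have hr : H.Reachable (t d) (s d) := by
    by_contra hcon
    -- Add up the degrees over the component of `t d` in `Z` without `d`. Every edge other than `d`
    -- has both or none of its ends there and contributes 0, but `d` would contribute 1.
    have hsum : ∑ e ∈ Z, ∑ x, inc s t e x * (if H.Reachable (t d) x then 1 else 0) = 0 := by
      rw [Finset.sum_comm]
      refine Finset.sum_eq_zero fun x _ => ?_
      rw [← Finset.sum_mul, hZ x, zero_mul]
    simp only [sum_inc_mul] at hsum
    rw [← Finset.add_sum_erase Z _ hd, Finset.sum_eq_zero (s := Z.erase d), if_neg hcon,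
      if_pos (SimpleGraph.Reachable.refl _)] at hsum
    · simp at hsum
    · intro e he
      have hiff : H.Reachable (t d) (s e) ↔ H.Reachable (t d) (t e) := by
        by_cases hne : s e = t e
        · rw [hne]
        · have hadj : H.Adj (s e) (t e) := ⟨hne, e, he, h e⟩
          exact ⟨fun H' => H'.trans hadj.reachable, fun H' => H'.trans hadj.symm.reachable⟩
      simp only [hiff]
      exact CharTwo.add_self_eq_zero _
  obtain ⟨C, hC, hdC, hsub⟩ := exists_cycle_of_reachable (Z := (Z.erase d : Set β)) (H := H)
    (fun x y hxy => hxy.2) (by simp) (h d) hr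
  refine ⟨C, hC, hdC, hsub.trans ?_⟩
  rw [← Finset.coe_insert, Finset.insert_erase hd]

lemma IsCycle.sum_inc {G : Graph α β} {s t : β → α}
    (h : ∀ e, G.IsLink e (s e) (t e)) {C : Finset β} (hC : IsCycle G (C : Set β)) (x : α) :
    ∑ e ∈ C, inc s t e x = 0 := by
  obtain ⟨n, v, e, -, he, hr, hl⟩ := hC
  have hC' : C = Finset.univ.image e := by
    rw [← Finset.coe_inj, ← hr]
    simp
  rw [hC', Finset.sum_image (fun i _ j _ hij => he hij)]
  simp only [fun i => inc_congr h (hl i) x, Finset.sum_add_distrib]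
  have := Equiv.sum_comp (Equiv.addRight (1 : Fin (n + 1)))
    (fun i => if v i = x then (1 : ZMod 2) else 0)
  simp only [Equiv.coe_addRight] at this
  exact (congrArg _ this).trans (CharTwo.add_self_eq_zero _)

/-! ### Cycles and cuts of the dual in the plane -/

/-- The kernel consists of functions that agree at the ends of every edge; by connectedness these
are constant, so its dimension is at most 1. -/
lemma card_le_rank_inc [Fintype α] [Fintype β] (s t : β → α)
    (hconn : ∀ u : α → ZMod 2, (∀ e, u (s e) = u (t e)) → ∀ x y, u x = u y) :
    Fintype.card α ≤ (inc s t).rank + 1 := by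
  have h1 := LinearMap.finrank_range_add_finrank_ker (inc s t).mulVecLin
  rw [Module.finrank_fintype_fun_eq_card] at h1
  have h2 : LinearMap.ker (inc s t).mulVecLin ≤ Submodule.span (ZMod 2) {fun _ => 1} := by
    intro u hu
    rw [LinearMap.mem_ker] at hu
    have h3 : ∀ e, u (s e) = u (t e) := by
      intro e
      have := congrFun hu e
      simp only [Matrix.mulVecLin_apply, Matrix.mulVec, dotProduct, sum_inc_mul,
        Pi.zero_apply] at this
      exact CharTwo.add_eq_zero.1 this
    rw [Submodule.mem_span_singleton]
    rcases isEmpty_or_nonempty α with hα | ⟨⟨x⟩⟩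
    · exact ⟨0, Subsingleton.elim _ _⟩
    · exact ⟨u x, funext fun y => by simpa using hconn u h3 x y⟩
  have h3 := (Submodule.finrank_mono h2).trans (finrank_span_le_card _)
  simp only [Set.toFinset_singleton, Finset.card_singleton] at h3
  rw [Matrix.rank]
  omega

lemma inc_eq_of_dart (f : β × Bool → α) (d : β × Bool) (x : α) :
    inc (fun e => f (e, false)) (fun e => f (e, true)) d.1 x =
      (if f d = x then 1 else 0) + (if f (rev β d) = x then 1 else 0) := by
  obtain ⟨e, b⟩ := d
  cases b
  · simp [inc, rev]
  · simp [inc, rev, add_comm]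

/-- The boundary of the boundary of a face vanishes. -/
lemma sum_inc_mul_inc [Fintype β] {tail : β × Bool → α} {face : β × Bool → Φ}
    {σ : Equiv.Perm (β × Bool)} (hσ : ∀ d, tail (σ d) = tail d)
    (hφ : ∀ d, face (rev β d) = face (σ d)) (x : α) (f : Φ) :
    ∑ e, inc (fun e => tail (e, false)) (fun e => tail (e, true)) e x *
      inc (fun e => face (e, false)) (fun e => face (e, true)) e f = 0 := by
  set w : β × Bool → ZMod 2 :=
    fun d => (if tail d = x then 1 else 0) * (if face d = f then 1 else 0) with hw
  have h1 : ∑ e, inc (fun e => tail (e, false)) (fun e => tail (e, true)) e x *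
      inc (fun e => face (e, false)) (fun e => face (e, true)) e f =
      ∑ d : β × Bool, (if tail d = x then 1 else 0) *
        inc (fun e => face (e, false)) (fun e => face (e, true)) d.1 f := by
    rw [Fintype.sum_prod_type]
    refine Finset.sum_congr rfl fun e _ => ?_
    rw [Fintype.sum_bool, ← add_mul, add_comm]
    rfl
  -- The face of the reversed dart is that of `σ d`, which has the same tail. Summed over all darts,
  -- the two terms therefore agree and cancel modulo 2.
  have h2 : ∀ d, (if tail d = x then 1 else 0) *
      inc (fun e => face (e, false)) (fun e => face (e, true)) d.1 f = w d + w (σ d) := by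
    intro d
    rw [inc_eq_of_dart, hw]
    simp only [hσ, hφ]
    ring
  rw [h1]
  simp only [h2, Finset.sum_add_distrib, Equiv.sum_comp σ w]
  exact CharTwo.add_self_eq_zero _

lemma range_inc_le_ker [Fintype α] [Fintype β] [Fintype Φ] {tail : β × Bool → α}
    {face : β × Bool → Φ} {σ : Equiv.Perm (β × Bool)} (hσ : ∀ d, tail (σ d) = tail d)
    (hφ : ∀ d, face (rev β d) = face (σ d)) :
    LinearMap.range (inc (fun e => face (e, false)) (fun e => face (e, true))).mulVecLin ≤
      LinearMap.ker
        (inc (fun e => tail (e, false)) (fun e => tail (e, true))).transpose.mulVecLin := by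
  rintro _ ⟨u, rfl⟩
  rw [LinearMap.mem_ker, Matrix.mulVecLin_apply, Matrix.mulVecLin_apply, Matrix.mulVec_mulVec]
  have : (inc (fun e => tail (e, false)) (fun e => tail (e, true))).transpose *
      inc (fun e => face (e, false)) (fun e => face (e, true)) = 0 := by
    ext x f
    rw [Matrix.mul_apply]
    exact sum_inc_mul_inc hσ hφ x f
  rw [this, Matrix.zero_mulVec]

/-- The Euler characteristic of a closed surface is at most `2`. -/
lemma card_add_card_le [Fintype α] [Fintype β] [Fintype Φ] {tail : β × Bool → α}
    {face : β × Bool → Φ} {σ : Equiv.Perm (β × Bool)} (hσ : ∀ d, tail (σ d) = tail d)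
    (hφ : ∀ d, face (rev β d) = face (σ d))
    (hα : ∀ u : α → ZMod 2, (∀ e, u (tail (e, false)) = u (tail (e, true))) → ∀ x y, u x = u y)
    (hΦ : ∀ u : Φ → ZMod 2, (∀ e, u (face (e, false)) = u (face (e, true))) → ∀ x y, u x = u y) :
    Fintype.card α + Fintype.card Φ ≤ Fintype.card β + 2 := by
  have h1 := card_le_rank_inc _ _ hα
  have h2 := card_le_rank_inc _ _ hΦ
  have h3 := LinearMap.finrank_range_add_finrank_ker
    (inc (fun e => tail (e, false)) (fun e => tail (e, true))).transpose.mulVecLin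
  rw [Module.finrank_fintype_fun_eq_card, ← Matrix.rank, Matrix.rank_transpose] at h3
  have h4 := Submodule.finrank_mono (range_inc_le_ker hσ hφ)
  rw [← Matrix.rank] at h4
  omega

/-- In the sphere, every cycle is the boundary of a set of faces. -/
lemma exists_faces_of_cycle [Fintype α] [Fintype β] [Fintype Φ] {G : Graph α β}
    {tail : β × Bool → α} {face : β × Bool → Φ} {σ : Equiv.Perm (β × Bool)}
    (hσ : ∀ d, tail (σ d) = tail d) (hφ : ∀ d, face (rev β d) = face (σ d))
    (hG : ∀ e, G.IsLink e (tail (e, false)) (tail (e, true)))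
    (hα : ∀ u : α → ZMod 2, (∀ e, u (tail (e, false)) = u (tail (e, true))) → ∀ x y, u x = u y)
    (hΦ : ∀ u : Φ → ZMod 2, (∀ e, u (face (e, false)) = u (face (e, true))) → ∀ x y, u x = u y)
    (heuler : Fintype.card β + 2 ≤ Fintype.card α + Fintype.card Φ)
    {C : Finset β} (hC : IsCycle G (C : Set β)) :
    ∃ U : Set Φ, ∀ e, e ∈ C ↔ ¬(face (e, false) ∈ U ↔ face (e, true) ∈ U) := by
  set A := inc (fun e => tail (e, false)) (fun e => tail (e, true)) with hA
  set B := inc (fun e => face (e, false)) (fun e => face (e, true)) with hB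
  have hle : LinearMap.range B.mulVecLin ≤ LinearMap.ker A.transpose.mulVecLin :=
    range_inc_le_ker hσ hφ
  have h1 : Fintype.card α ≤ A.rank + 1 := card_le_rank_inc _ _ hα
  have h2 : Fintype.card Φ ≤ B.rank + 1 := card_le_rank_inc _ _ hΦ
  have h3 := LinearMap.finrank_range_add_finrank_ker A.transpose.mulVecLin
  rw [Module.finrank_fintype_fun_eq_card, ← Matrix.rank, Matrix.rank_transpose] at h3
  -- Exactness by dimension count: the kernel has dimension |E| - rank A ≤ |E| - |V| + 1, which by
  -- Euler's formula is at most the number of faces minus 1, hence at most rank B.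
  have heq := Submodule.eq_of_le_of_finrank_le hle (by rw [← Matrix.rank]; omega)
  have hmem : (fun e => if e ∈ C then (1 : ZMod 2) else 0) ∈ LinearMap.range B.mulVecLin := by
    rw [heq, LinearMap.mem_ker]
    ext x
    simp only [Matrix.mulVecLin_apply, Matrix.mulVec, dotProduct, Matrix.transpose_apply,
      mul_ite, mul_one, mul_zero, Pi.zero_apply, Finset.sum_ite_mem, Finset.univ_inter]
    exact hC.sum_inc hG x
  obtain ⟨u, hu⟩ := hmem
  refine ⟨{f | u f = 1}, fun e => ?_⟩
  have h4 := congrFun hu e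
  simp only [Matrix.mulVecLin_apply, Matrix.mulVec, dotProduct, hB, sum_inc_mul] at h4
  simp only [Set.mem_ofPred_eq]
  have key : ∀ a b : ZMod 2, (a + b = 1 ∧ ¬(a = 1 ↔ b = 1)) ∨ (a + b = 0 ∧ (a = 1 ↔ b = 1)) := by
    decide
  by_cases he : e ∈ C
  · simp only [he, if_true] at h4
    rcases key (u (face (e, false))) (u (face (e, true))) with H | H
    · exact iff_of_true he H.2
    · exact absurd (h4.symm.trans H.1) (by decide)
  · simp only [he, if_false] at h4
    rcases key (u (face (e, false))) (u (face (e, true))) with H | H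
    · exact absurd (h4.symm.trans H.1) (by decide)
    · exact iff_of_false he (not_not.2 H.2)

/-- The boundary of a set of faces contains a cycle through each of its edges. -/
lemma exists_cycle_of_faces [Fintype α] [Fintype β] [Finite Φ] {G : Graph α β}
    {tail : β × Bool → α} {face : β × Bool → Φ} {σ : Equiv.Perm (β × Bool)}
    (hσ : ∀ d, tail (σ d) = tail d) (hφ : ∀ d, face (rev β d) = face (σ d))
    (hG : ∀ e, G.IsLink e (tail (e, false)) (tail (e, true))) {U : Set Φ} {C : Finset β}
    (hC : ∀ e, e ∈ C ↔ ¬(face (e, false) ∈ U ↔ face (e, true) ∈ U)) {d : β} (hd : d ∈ C) :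
    ∃ C', IsCycle G C' ∧ d ∈ C' ∧ C' ⊆ C := by
  have := Fintype.ofFinite Φ
  refine exists_cycle_of_even hG C (fun x => ?_) hd
  set u : Φ → ZMod 2 := fun f => if f ∈ U then 1 else 0 with hu
  have h1 : ∀ e, u (face (e, false)) + u (face (e, true)) = if e ∈ C then 1 else 0 := by
    intro e
    simp only [hC, hu]
    by_cases h1 : face (e, false) ∈ U <;> by_cases h2 : face (e, true) ∈ U <;>
      simp [h1, h2, CharTwo.add_self_eq_zero]
  calc ∑ e ∈ C, inc (fun e => tail (e, false)) (fun e => tail (e, true)) e x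
      = ∑ e, inc (fun e => tail (e, false)) (fun e => tail (e, true)) e x *
          ∑ f, inc (fun e => face (e, false)) (fun e => face (e, true)) e f * u f := by
        simp only [sum_inc_mul, h1, mul_ite, mul_one, mul_zero, Finset.sum_ite_mem,
          Finset.univ_inter]
    _ = ∑ f, (∑ e, inc (fun e => tail (e, false)) (fun e => tail (e, true)) e x *
          inc (fun e => face (e, false)) (fun e => face (e, true)) e f) * u f := by
        simp only [Finset.mul_sum, Finset.sum_mul]
        rw [Finset.sum_comm]
        simp only [mul_assoc]
    _ = 0 := by simp [sum_inc_mul_inc hσ hφ]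

end Cycles

/-! ### Plane duality and the upper bound for `D`-cycles. -/

section Duality

open Classical Relation

lemma sameCycle_congr {γ δ : Type*} {σ : Equiv.Perm γ} {w : γ → δ} (h : ∀ d, w (σ d) = w d)
    {d d' : γ} (hd : σ.SameCycle d d') : w d = w d' := by
  obtain ⟨i, rfl⟩ := hd
  induction i with
  | zero => simp
  | succ n ih => rw [ih, add_comm, zpow_add, zpow_one, Equiv.Perm.mul_apply, h]
  | pred n ih =>
    rw [ih, ← h ((σ ^ (-(n : ℤ) - 1)) d), ← Equiv.Perm.mul_apply, ← zpow_one_add]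
    congr 3
    ring

lemma rev_rev {β : Type*} (d : β × Bool) : rev β (rev β d) = d := by
  obtain ⟨e, b⟩ := d
  cases b <;> rfl

/-- The faces of the combinatorial embedding with rotation system `σ`. -/
abbrev Face {β : Type*} (σ : Equiv.Perm (β × Bool)) : Type _ :=
  Quotient (Equiv.Perm.SameCycle.setoid (σ * rev β))

/-- The face to which a dart belongs. -/
def faceOf {β : Type*} (σ : Equiv.Perm (β × Bool)) (d : β × Bool) : Face σ :=
  Quotient.mk _ d

lemma faceOf_eq_iff {β : Type*} {σ : Equiv.Perm (β × Bool)} {d d' : β × Bool} :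
    faceOf σ d = faceOf σ d' ↔ (σ * rev β).SameCycle d d' :=
  Quotient.eq

lemma faceOf_rev {β : Type*} (σ : Equiv.Perm (β × Bool)) (d : β × Bool) :
    faceOf σ (rev β d) = faceOf σ (σ d) := by
  rw [faceOf_eq_iff]
  refine ⟨1, ?_⟩
  rw [zpow_one, Equiv.Perm.mul_apply, rev_rev]

section

variable (I : Inst) {tail : I.Edge × Bool → I.Vert} {σ : Equiv.Perm (I.Edge × Bool)}
  (hG : ∀ e, I.graph.IsLink e (tail (e, false)) (tail (e, true)))
  (hσ : ∀ d d', σ.SameCycle d d' ↔ tail d = tail d')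
  (heuler : (Fintype.card I.Vert : ℤ) - Fintype.card I.Edge + faceCount σ = 2)

include hσ in
lemma tail_rotation (d : I.Edge × Bool) : tail (σ d) = tail d :=
  (hσ _ _).1 ((Equiv.Perm.SameCycle.refl σ d).apply_left)

include hG in
lemma vert_connected {δ : Type*} (u : I.Vert → δ)
    (hu : ∀ e, u (tail (e, false)) = u (tail (e, true))) (x y : I.Vert) : u x = u y := by
  have h := I.connected.2 x (by simp [I.vertexSet_eq]) y (by simp [I.vertexSet_eq])
  induction h with
  | refl => rfl
  | tail _ hbc ih =>
    obtain ⟨e, he⟩ := hbc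
    rw [ih]
    rcases (hG e).eq_and_eq_or_eq_and_eq he with ⟨h1, h2⟩ | ⟨h1, h2⟩
    · rw [← h1, ← h2, hu]
    · rw [← h1, ← h2, hu]

-- Connectedness of the dual. Since `σ d` and `rev d` lie on the same face, a function that agrees
-- across every edge is constant on the darts around a vertex, and then along walks of the primal
-- graph.
include hG hσ in
lemma face_connected {δ : Type*} (u : Face σ → δ)
    (hu : ∀ e, u (faceOf σ (e, false)) = u (faceOf σ (e, true))) (x y : Face σ) : u x = u y := by
  obtain ⟨d, rfl⟩ := Quotient.exists_rep x
  obtain ⟨d', rfl⟩ := Quotient.exists_rep y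
  change u (faceOf σ d) = u (faceOf σ d')
  have hrev : ∀ d, u (faceOf σ (rev _ d)) = u (faceOf σ d) := by
    rintro ⟨e, b⟩
    cases b
    · exact (hu e).symm
    · exact hu e
  have hrot : ∀ d d', tail d = tail d' → u (faceOf σ d) = u (faceOf σ d') := fun d d' h =>
    sameCycle_congr (w := fun d => u (faceOf σ d)) (fun d => by rw [← faceOf_rev, hrev])
      ((hσ d d').2 h)
  have h := I.connected.2 (tail d) (by simp [I.vertexSet_eq]) (tail d') (by simp [I.vertexSet_eq])
  have key : ∀ z, ReflTransGen I.graph.Adj (tail d) z → ∀ d'', tail d'' = z →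
      u (faceOf σ d) = u (faceOf σ d'') := by
    intro z hz
    induction hz with
    | refl => exact fun d'' h => hrot _ _ h.symm
    | tail _ hbc ih =>
      intro d'' hd''
      obtain ⟨e, he⟩ := hbc
      rcases (hG e).eq_and_eq_or_eq_and_eq he with ⟨h1, h2⟩ | ⟨h1, h2⟩
      · rw [ih _ h1, hu, hrot _ _ (h2.trans hd''.symm)]
      · rw [ih _ h2, ← hu, hrot _ _ (h1.trans hd''.symm)]
  exact key _ h d' rfl

include hG hσ heuler in
/-- In the plane, covering `D`-cycles and covering `D`-cuts of the dual are the same problem. -/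
theorem coverFeasible_dCycles [Nonempty I.Edge] :
    coverFeasible (dCycles I) = coverFeasible
      (demandCuts (fun e => faceOf σ (e, false)) (fun e => faceOf σ (e, true)) I.demand) := by
  have : Fintype (Face σ) := Fintype.ofFinite _
  refine Set.Subset.antisymm (coverFeasible_subset ?_) (coverFeasible_subset ?_)
  · rintro C ⟨⟨U, hU⟩, d, ⟨hdC, hdD⟩, hu⟩
    obtain ⟨C', hC', hd, hsub⟩ := exists_cycle_of_faces (tail_rotation I hσ)
      (faceOf_rev σ) hG hU hdC
    have hC'C : C'.toFinite.toFinset ⊆ C := by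
      intro e he
      exact hsub (by simpa using he)
    exact ⟨C'.toFinite.toFinset, ⟨by simpa using hC', d, ⟨by simpa using hd, hdD⟩,
      fun e he => hu e ⟨hC'C he.1, he.2⟩⟩, hC'C⟩
  · rintro C ⟨hC, hu⟩
    refine ⟨C, ⟨?_, hu⟩, subset_rfl⟩
    refine exists_faces_of_cycle (tail_rotation I hσ) (faceOf_rev σ) hG
      (vert_connected I hG) (face_connected I hG hσ) ?_ hC
    rw [faceCount, if_neg (not_isEmpty_of_nonempty _),
      show Nat.card _ = Fintype.card (Face σ) from Nat.card_eq_fintype_card] at heuler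
    omega

end

theorem integralityGap_dCycles_le : integralityGap IsPlanar dCycles ≤ 2 := by
  refine iSup₂_le fun I hI => ENNReal.div_le_of_le_mul ?_
  obtain ⟨tail, σ, hG, hσ, heuler⟩ := hI
  -- Without edges `faceCount` is 1 by convention, not a number of orbits. This case is trivial:
  -- there are no `D`-cycles and the zero vector is feasible.
  rcases isEmpty_or_nonempty I.Edge with hE | hE
  · have h : (fun _ => 0 : I.Edge → ℝ) ∈ coverFeasible (dCycles I) ∩ integral I.Edge :=
      ⟨⟨fun C hC => by obtain ⟨e, -⟩ := hC.2; exact isEmptyElim e, fun e => isEmptyElim e⟩,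
        fun e => isEmptyElim e⟩
    refine (iInf₂_le _ h).trans ?_
    simp
  · have h := coverFeasible_dCycles I hG hσ heuler
    rw [lpValue_congr h, ipValue_congr h]
    exact ipValue_demandCuts_le _ _ I.demand

/-! ### The dual of a plane instance -/

/-- The multigraph in which the edge `e` has the ends `s e` and `t e`. -/
def graphOfEnds {α β : Type*} (s t : β → α) : Graph α β where
  vertexSet := Set.univ
  IsLink e x y := (s e = x ∧ t e = y) ∨ (s e = y ∧ t e = x)
  edgeSet := Set.univ
  isLink_symm _ _ := ⟨fun _ _ h => h.symm⟩
  eq_or_eq_of_isLink_of_isLink _ _ _ _ _ h h' := by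
    rcases h with ⟨rfl, rfl⟩ | ⟨rfl, rfl⟩ <;> rcases h' with ⟨rfl, rfl⟩ | ⟨rfl, rfl⟩ <;> simp
  edge_mem_iff_exists_isLink e := ⟨fun _ => ⟨_, _, Or.inl ⟨rfl, rfl⟩⟩, fun _ => Set.mem_univ _⟩
  left_mem_of_isLink _ _ _ _ := Set.mem_univ _

lemma graphOfEnds_isLink {α β : Type*} (s t : β → α) (e : β) :
    (graphOfEnds s t).IsLink e (s e) (t e) := Or.inl ⟨rfl, rfl⟩

lemma graphOfEnds_connected {α β : Type*} [Nonempty α] {s t : β → α}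
    (h : ∀ u : α → Prop, (∀ e, u (s e) = u (t e)) → ∀ x y, u x = u y) :
    IsConnected (graphOfEnds s t) := by
  refine ⟨Set.univ_nonempty, fun x _ y _ => ?_⟩
  have h1 := h (fun z => ReflTransGen (graphOfEnds s t).Adj x z) (fun e => propext
    ⟨fun H => H.tail ⟨e, graphOfEnds_isLink s t e⟩,
      fun H => H.tail ⟨e, (graphOfEnds_isLink s t e).symm⟩⟩) x y
  exact h1 ▸ ReflTransGen.refl

/-- A plane instance without isolated vertices has a plane dual, whose `D`-cut covering problem is
the `D`-cycle covering problem of the given instance. -/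
theorem exists_dual (I : Inst) [Nonempty I.Edge] {tail : I.Edge × Bool → I.Vert}
    {σ : Equiv.Perm (I.Edge × Bool)}
    (hG : ∀ e, I.graph.IsLink e (tail (e, false)) (tail (e, true)))
    (hσ : ∀ d d', σ.SameCycle d d' ↔ tail d = tail d')
    (heuler : (Fintype.card I.Vert : ℤ) - Fintype.card I.Edge + faceCount σ = 2)
    (hsurj : Function.Surjective tail) :
    ∃ J : Inst, IsPlanar J ∧ lpValue (dCuts J) = lpValue (dCycles I) ∧
      ipValue (dCuts J) = ipValue (dCycles I) := by
  have : Fintype (Face σ) := Fintype.ofFinite _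
  have hne : Nonempty (Face σ) := ⟨faceOf σ (Classical.arbitrary I.Edge, true)⟩
  let J : Inst :=
    { Vert := Face σ
      Edge := I.Edge
      graph := graphOfEnds (fun e => faceOf σ (e, false)) (fun e => faceOf σ (e, true))
      vertexSet_eq := rfl
      edgeSet_eq := rfl
      connected := graphOfEnds_connected (face_connected I hG hσ)
      demand := I.demand }
  have hJ : ∀ e, J.graph.IsLink e (faceOf σ (e, false)) (faceOf σ (e, true)) :=
    graphOfEnds_isLink _ _
  have h := (coverFeasible_dCuts J hJ).trans (coverFeasible_dCycles I hG hσ heuler).symm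
  refine ⟨J, ⟨faceOf σ, σ * rev _, hJ, fun d d' => faceOf_eq_iff.symm, ?_⟩,
    lpValue_congr h, ipValue_congr h⟩
  -- Face tracing in the dual is the primal rotation. Its orbits are the primal vertices, provided
  -- that every vertex has a dart, so Euler's formula carries over.
  have h1 : σ * rev I.Edge * rev I.Edge = σ := by
    ext1 d
    simp only [Equiv.Perm.mul_apply, rev_rev]
  have h2 : Nat.card (Quotient (Equiv.Perm.SameCycle.setoid σ)) = Fintype.card I.Vert := by
    rw [← Nat.card_eq_fintype_card]
    refine Nat.card_eq_of_bijective
      (Quotient.lift tail fun d d' h => (hσ d d').1 h : _ → I.Vert) ⟨?_, ?_⟩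
    · intro x y
      refine Quotient.inductionOn₂ x y fun d d' h => ?_
      exact Quotient.sound ((hσ d d').2 h)
    · intro x
      obtain ⟨d, hd⟩ := hsurj x
      exact ⟨Quotient.mk _ d, hd⟩
  have hEJ : ¬ IsEmpty J.Edge := not_isEmpty_of_nonempty I.Edge
  rw [faceCount, if_neg (not_isEmpty_of_nonempty _),
      show Nat.card _ = Fintype.card (Face σ) from Nat.card_eq_fintype_card] at heuler
  rw [faceCount, if_neg hEJ]
  change (Fintype.card (Face σ) : ℤ) - Fintype.card I.Edge +
    (Nat.card (Quotient (Equiv.Perm.SameCycle.setoid (σ * rev I.Edge * rev I.Edge))) : ℕ) = 2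
  rw [h1, h2]
  linarith

end Duality

/-! ### The lower bound 3/2: a rotation system for the ladder. -/

section Ladder

variable {k : ℕ}

/-! ### Paths with doubled vertices

The vertices are `(i, p)` with a level `i ≤ k + 1` and `p : Bool`; the edge `(i, p, q)` joins
`(i, p)` and `(i + 1, q)`, and it is a demand edge if `p = false`. -/

/-- The lower end of an edge. -/
def lowEnd (e : Fin (k + 1) × Bool × Bool) : Fin (k + 2) × Bool := (e.1.castSucc, e.2.1)

/-- The upper end of an edge. -/
def highEnd (e : Fin (k + 1) × Bool × Bool) : Fin (k + 2) × Bool := (e.1.succ, e.2.2)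

/-- The initial vertex of a dart. -/
def ladderTail (d : (Fin (k + 1) × Bool × Bool) × Bool) : Fin (k + 2) × Bool :=
  if d.2 then highEnd d.1 else lowEnd d.1

/-- The next dart in the rotation. -/
def ladderNext :
    (Fin (k + 1) × Bool × Bool) × Bool → (Fin (k + 1) × Bool × Bool) × Bool
  | ((i, p, q), false) =>
    if p = q then ((i, p, !p), false)
    else if (i : ℕ) = 0 then ((i, p, p), false) else ((⟨i - 1, by omega⟩, p, p), true)
  | ((i, p, q), true) =>
    if p = q then ((i, !q, q), true)
    else if h : (i : ℕ) < k then ((⟨i + 1, by omega⟩, q, q), false) else ((i, q, q), true)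

/-- The previous dart in the rotation. -/
def ladderPrev :
    (Fin (k + 1) × Bool × Bool) × Bool → (Fin (k + 1) × Bool × Bool) × Bool
  | ((i, p, q), false) =>
    if p ≠ q then ((i, p, p), false)
    else if (i : ℕ) = 0 then ((i, p, !p), false) else ((⟨i - 1, by omega⟩, !p, p), true)
  | ((i, p, q), true) =>
    if p ≠ q then ((i, q, q), true)
    else if h : (i : ℕ) < k then ((⟨i + 1, by omega⟩, q, !q), false) else ((i, !q, q), true)

/-- The rotation system of a plane embedding. -/
def ladderRotation : Equiv.Perm ((Fin (k + 1) × Bool × Bool) × Bool) where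
  toFun := ladderNext
  invFun := ladderPrev
  left_inv := by
    rintro ⟨⟨⟨i, hi⟩, p, q⟩, b⟩
    by_cases h0 : i = 0 <;> by_cases hk : i < k <;>
      cases p <;> cases q <;> cases b <;>
      simp [ladderNext, ladderPrev, h0, hk, -Fin.val_eq_zero_iff] <;> grind
  right_inv := by
    rintro ⟨⟨⟨i, hi⟩, p, q⟩, b⟩
    by_cases h0 : i = 0 <;> by_cases hk : i < k <;>
      cases p <;> cases q <;> cases b <;>
      simp [ladderNext, ladderPrev, h0, hk, -Fin.val_eq_zero_iff] <;> grind

lemma ladderTail_rotation (d : (Fin (k + 1) × Bool × Bool) × Bool) :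
    ladderTail (ladderRotation d) = ladderTail d := by
  obtain ⟨⟨⟨i, hi⟩, p, q⟩, b⟩ := d
  by_cases h0 : i = 0 <;> by_cases hk : i < k <;>
    cases p <;> cases q <;> cases b <;>
    simp [ladderRotation, ladderNext, ladderTail, lowEnd, highEnd, h0, hk,
      -Fin.val_eq_zero_iff] <;> (try split_ifs) <;>
      first | grind | simp

/-- A dart that leaves a given vertex. -/
def ladderDart (x : Fin (k + 2) × Bool) : (Fin (k + 1) × Bool × Bool) × Bool :=
  if h : (x.1 : ℕ) < k + 1 then ((⟨x.1, h⟩, x.2, x.2), false) else ((Fin.last k, x.2, x.2), true)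

lemma ladderTail_dart (x : Fin (k + 2) × Bool) : ladderTail (ladderDart x) = x := by
  obtain ⟨i, p⟩ := x
  by_cases h : (i : ℕ) < k + 1
  · simp [ladderDart, h, ladderTail, lowEnd]
  · simp [ladderDart, h, ladderTail, highEnd, Fin.ext_iff]
    omega

/-- The order around an inner vertex is: same side up, other side up, same side down, other side
down. Geometrically, the 4-cycles between consecutive levels are concentric, and neighbouring ones
touch in the two vertices of their common level. -/
lemma ladderRotation_sameCycle_dart (d : (Fin (k + 1) × Bool × Bool) × Bool) :
    ladderRotation.SameCycle d (ladderDart (ladderTail d)) := by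
  have step : ∀ d : (Fin (k + 1) × Bool × Bool) × Bool,
      ladderRotation.SameCycle d (ladderNext d) := fun d => ⟨1, by simp [ladderRotation]⟩
  obtain ⟨⟨i, p, q⟩, b⟩ := d
  cases b
  · have hd : ladderDart (ladderTail ((i, p, q), false)) = ((i, p, p), false) := by
      simp [ladderDart, ladderTail, lowEnd, Nat.lt_succ_iff.1 i.2]
    rw [hd]
    by_cases hpq : p = q
    · subst hpq
      exact Equiv.Perm.SameCycle.refl _ _
    · have h := step ((i, p, p), false)
      rw [show ladderNext ((i, p, p), false) = ((i, p, q), false) by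
        cases p <;> cases q <;> simp_all [ladderNext]] at h
      exact h.symm
  · by_cases hi : (i : ℕ) < k
    · have hd : ladderDart (ladderTail ((i, p, q), true)) =
          ((⟨i + 1, by omega⟩, q, q), false) := by
        simp [ladderDart, ladderTail, highEnd, hi]
      have h1 := step ((i, !q, q), true)
      rw [show ladderNext ((i, !q, q), true) = ((⟨i + 1, by omega⟩, q, q), false) by
        cases q <;> simp [ladderNext, hi]] at h1
      rw [hd]
      by_cases hpq : p = q
      · subst hpq
        have h2 := step ((i, p, p), true)
        rw [show ladderNext ((i, p, p), true) = ((i, !p, p), true) by simp [ladderNext]] at h2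
        exact h2.trans h1
      · rwa [show p = !q by cases p <;> cases q <;> simp_all]
    · have hd : ladderDart (ladderTail ((i, p, q), true)) = ((i, q, q), true) := by
        simp [ladderDart, ladderTail, highEnd, hi, Fin.ext_iff]
        omega
      rw [hd]
      by_cases hpq : p = q
      · subst hpq
        exact Equiv.Perm.SameCycle.refl _ _
      · have h := step ((i, p, q), true)
        rwa [show ladderNext ((i, p, q), true) = ((i, q, q), true) by
          simp [ladderNext, hi, hpq]] at h

lemma ladderRotation_sameCycle_iff (d d' : (Fin (k + 1) × Bool × Bool) × Bool) :
    ladderRotation.SameCycle d d' ↔ ladderTail d = ladderTail d' := by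
  refine ⟨sameCycle_congr ladderTail_rotation, fun h => ?_⟩
  have h1 := ladderRotation_sameCycle_dart d
  rw [h] at h1
  exact h1.trans (ladderRotation_sameCycle_dart d').symm

/-- The face of a dart, as a level and a side; all faces on the first level are identified, and so
are all faces on the last level. -/
def ladderFace (d : (Fin (k + 1) × Bool × Bool) × Bool) : ℕ × Bool :=
  let x : ℕ × Bool :=
    if d.1.2.1 = d.1.2.2 then (if d.2 then (d.1.1 + 1, d.1.2.1) else (d.1.1, !d.1.2.1))
    else (if d.2 then (d.1.1, d.1.2.1) else (d.1.1 + 1, d.1.2.1))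
  if x.1 = 0 ∨ x.1 = k + 1 then (x.1, false) else x

lemma ladderFace_rotation (d : (Fin (k + 1) × Bool × Bool) × Bool) :
    ladderFace (ladderRotation d) = ladderFace (rev _ d) := by
  obtain ⟨⟨⟨i, hi⟩, p, q⟩, b⟩ := d
  by_cases h0 : i = 0 <;> by_cases hk : i < k <;>
    cases p <;> cases q <;> cases b <;>
    simp [ladderRotation, ladderNext, ladderFace, rev, h0, hk, -Fin.val_eq_zero_iff] <;> grind

end Ladder

/-! ### The ladder instance: planarity, fractional and integral covers. -/

section Ladder

open Classical

variable {k : ℕ}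

lemma ladderTail_isLink (e : Fin (k + 1) × Bool × Bool) :
    (graphOfEnds (lowEnd (k := k)) highEnd).IsLink e (ladderTail (e, false))
      (ladderTail (e, true)) :=
  graphOfEnds_isLink _ _ e

lemma ladder_connected {δ : Type*} (u : Fin (k + 2) × Bool → δ)
    (hu : ∀ e, u (lowEnd e) = u (highEnd e)) (x y : Fin (k + 2) × Bool) : u x = u y := by
  have h1 : ∀ (i : Fin (k + 2)) (p : Bool), u (i, p) = u (0, true) := by
    intro i
    induction i using Fin.induction with
    | zero =>
      intro p
      have h2 := hu (0, p, true)
      have h3 := hu (0, true, true)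
      simp only [lowEnd, highEnd, Fin.castSucc_zero] at h2 h3
      rw [h2, h3]
    | succ i ih =>
      intro p
      have h2 := hu (i, true, p)
      simp only [lowEnd, highEnd] at h2
      rw [← h2, ih]
  rw [h1 x.1 x.2, h1 y.1 y.2]

/-- The instance on a path with doubled vertices. -/
def ladderInst (k : ℕ) : Inst where
  Vert := Fin (k + 2) × Bool
  Edge := Fin (k + 1) × Bool × Bool
  graph := graphOfEnds lowEnd highEnd
  vertexSet_eq := rfl
  edgeSet_eq := rfl
  connected := graphOfEnds_connected ladder_connected
  demand := {e | e.2.1 = false}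

/-- The label `ladderFace` is invariant under face tracing and separates the chosen darts: two faces
at each of the levels 1 to k, one at each extreme. A lower bound suffices, because
`card_add_card_le` bounds the number of faces from above. -/
lemma card_ladder_faces_le : 2 * (k + 1) ≤ Nat.card (Face (ladderRotation (k := k))) := by
  let r : Fin k × Bool ⊕ Bool → (Fin (k + 1) × Bool × Bool) × Bool :=
    Sum.elim (fun x => ((x.1.castSucc, x.2, !x.2), false))
      (fun b => if b then ((Fin.last k, true, false), false) else ((0, true, true), false))
  have hinj : Function.Injective fun x => faceOf ladderRotation (r x) := by
    intro x y hxy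
    have h1 : ladderFace (r x) = ladderFace (r y) := by
      refine sameCycle_congr (fun d => ?_) (faceOf_eq_iff.1 hxy)
      rw [Equiv.Perm.mul_apply, ladderFace_rotation, rev_rev]
    rcases x with ⟨i, p⟩ | b <;> rcases y with ⟨j, q⟩ | c
    · have hi := i.2.ne
      have hj := j.2.ne
      simp [r, ladderFace, hi, hj] at h1
      simp [Fin.ext_iff, h1]
    · have hi := i.2.ne
      cases c <;> simp [r, ladderFace, hi] at h1
    · have hj := j.2.ne
      cases b <;> simp [r, ladderFace, hj] at h1
      omega
    · cases b <;> cases c <;> simp [r, ladderFace] at h1 ⊢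
  have h2 := Nat.card_le_card_of_injective _ hinj
  simp only [Nat.card_eq_fintype_card, Fintype.card_sum, Fintype.card_prod, Fintype.card_fin,
    Fintype.card_bool] at h2
  rw [← Nat.card_eq_fintype_card] at h2
  omega

lemma ladder_euler : (Fintype.card (ladderInst k).Vert : ℤ) - Fintype.card (ladderInst k).Edge +
    faceCount (ladderRotation (k := k)) = 2 := by
  have : Fintype (Face (ladderRotation (k := k))) := Fintype.ofFinite _
  have h1 := card_add_card_le (tail_rotation (ladderInst k) ladderRotation_sameCycle_iff)
    (faceOf_rev (ladderRotation (k := k)))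
    (vert_connected (ladderInst k) ladderTail_isLink)
    (face_connected (ladderInst k) ladderTail_isLink ladderRotation_sameCycle_iff)
  have h2 := card_ladder_faces_le (k := k)
  have h3 : Fintype.card (ladderInst k).Vert = (k + 2) * 2 := by
    change Fintype.card (Fin (k + 2) × Bool) = _
    simp
  have h4 : Fintype.card (ladderInst k).Edge = (k + 1) * 4 := by
    change Fintype.card (Fin (k + 1) × Bool × Bool) = _
    simp
  rw [faceCount, if_neg (not_isEmpty_of_nonempty _)]
  rw [← Nat.card_eq_fintype_card (α := Face _)] at h1
  change (Fintype.card (ladderInst k).Vert : ℤ) - Fintype.card (ladderInst k).Edge +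
    (Nat.card (Face (ladderRotation (k := k))) : ℕ) = 2
  omega

lemma ladder_planar : IsPlanar (ladderInst k) :=
  ⟨ladderTail, ladderRotation, ladderTail_isLink, ladderRotation_sameCycle_iff, ladder_euler⟩

/-! ### The value of the linear program -/

lemma ladder_level {e : Fin (k + 1) × Bool × Bool} {x y : Fin (k + 2) × Bool}
    (h : (graphOfEnds (lowEnd (k := k)) highEnd).IsLink e x y) :
    (x.1 : ℕ) + 1 = y.1 ∨ (y.1 : ℕ) + 1 = x.1 := by
  rcases h with ⟨rfl, rfl⟩ | ⟨rfl, rfl⟩ <;> simp [lowEnd, highEnd]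

lemma ladder_edge_ext {e f : Fin (k + 1) × Bool × Bool} (h1 : lowEnd e = lowEnd f)
    (h2 : highEnd e = highEnd f) : e = f := by
  simp only [lowEnd, highEnd, Prod.mk.injEq, Fin.castSucc_inj] at h1 h2
  exact Prod.ext h1.1 (Prod.ext h1.2 h2.2)

lemma ladder_edge_unique {e f : Fin (k + 1) × Bool × Bool} {x y : Fin (k + 2) × Bool}
    (he : (graphOfEnds (lowEnd (k := k)) highEnd).IsLink e x y)
    (hf : (graphOfEnds (lowEnd (k := k)) highEnd).IsLink f x y) : e = f := by
  have key : ∀ e f : Fin (k + 1) × Bool × Bool, lowEnd e = highEnd f → highEnd e = lowEnd f →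
      e = f := by
    intro e f h1 h2
    simp only [lowEnd, highEnd, Prod.mk.injEq, Fin.ext_iff, Fin.val_castSucc, Fin.val_succ] at h1 h2
    omega
  rcases he with ⟨h1, h2⟩ | ⟨h1, h2⟩ <;> rcases hf with ⟨h3, h4⟩ | ⟨h3, h4⟩
  · exact ladder_edge_ext (h1.trans h3.symm) (h2.trans h4.symm)
  · exact key _ _ (h1.trans h4.symm) (h2.trans h3.symm)
  · exact key _ _ (h1.trans h4.symm) (h2.trans h3.symm)
  · exact ladder_edge_ext (h1.trans h3.symm) (h2.trans h4.symm)

/-- The level changes by one along each edge, which excludes the lengths 1 and 3; length 2 would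
need parallel edges. -/
lemma four_le_card_of_cycle {C : Finset (ladderInst k).Edge}
    (hC : IsCycle (ladderInst k).graph (C : Set (ladderInst k).Edge)) : 4 ≤ C.card := by
  obtain ⟨n, v, e, hv, he, hr, hl⟩ := hC
  have hcard : C.card = n + 1 := by
    have hC' : C = Finset.univ.image e := by
      rw [← Finset.coe_inj, ← hr]
      simp
    rw [hC', Finset.card_image_of_injective _ he, Finset.card_fin]
  have hlev := fun i => ladder_level (hl i)
  rw [hcard]
  by_contra hn
  have hn' : n = 0 ∨ n = 1 ∨ n = 2 := by omega
  rcases hn' with rfl | rfl | rfl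
  · have h0 := hlev 0
    simp at h0
  · have h0 := hl 0
    have h1 := (hl 1).symm
    exact absurd (he (ladder_edge_unique h0 h1)) (by decide)
  · have h0 := hlev 0
    have h1 := hlev 1
    have h2 := hlev 2
    rw [show (0 : Fin 3) + 1 = 1 from rfl] at h0
    rw [show (1 : Fin 3) + 1 = 2 from rfl] at h1
    rw [show (2 : Fin 3) + 1 = 0 from rfl] at h2
    omega

lemma ladder_lpValue_le :
    lpValue (dCycles (ladderInst k)) ≤ ENNReal.ofReal (2 / 3 * (k + 1)) := by
  have hfeas : (fun e => if e.2.1 = true then 1 / 3 else 0 : Fin (k + 1) × Bool × Bool → ℝ) ∈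
      coverFeasible (dCycles (ladderInst k)) := by
    refine ⟨fun C hC => ?_, fun e => by positivity⟩
    have h4 := four_le_card_of_cycle hC.1
    have h1 : (C.filter (· ∈ (ladderInst k).demand)).card = 1 := by
      rw [card_eq_one_iff_existsUnique]
      simpa using hC.2
    have h2 := Finset.card_filter_add_card_filter_not (s := C) (· ∈ (ladderInst k).demand)
    have h3 : 3 ≤ (C.filter (¬ · ∈ (ladderInst k).demand)).card := by omega
    have h5 : ∀ e : (ladderInst k).Edge, (if e.2.1 = true then 1 / 3 else 0 : ℝ) =
        if ¬ e ∈ (ladderInst k).demand then 1 / 3 else 0 := by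
      intro e
      have hd : e ∉ (ladderInst k).demand ↔ e.2.1 = true := Bool.not_eq_false _ ▸ Iff.rfl
      simp only [hd]
    simp only [h5]
    rw [← Finset.sum_filter, Finset.sum_const, nsmul_eq_mul]
    have h6 : (3 : ℝ) ≤ (C.filter (¬ · ∈ (ladderInst k).demand)).card := by exact_mod_cast h3
    linarith
  refine (iInf₂_le _ hfeas).trans (ENNReal.ofReal_le_ofReal (le_of_eq ?_))
  change ∑ e : Fin (k + 1) × Bool × Bool, _ = _
  simp only [Fintype.sum_prod_type, Fintype.sum_bool]
  simp
  ring

/-! ### The value of the integer program -/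

/-- A value 2 at `j + 1` makes up for a small value at `j`. The second conjunct records the surplus
of 1 that the induction needs when `f n` is itself at least 1. -/
lemma le_sum_of_alternative {n : ℕ} {f : ℕ → ℝ} (hf : ∀ j, 0 ≤ f j)
    (h : ∀ j < n, 1 ≤ f j ∨ 2 ≤ f (j + 1)) :
    (n : ℝ) ≤ ∑ j ∈ Finset.range (n + 1), f j ∧
      (1 ≤ f n → (n + 1 : ℝ) ≤ ∑ j ∈ Finset.range (n + 1), f j) := by
  induction n with
  | zero => simpa using hf 0
  | succ n ih =>
    obtain ⟨h1, h2⟩ := ih fun j hj => h j (hj.trans (Nat.lt_succ_self n))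
    rw [Finset.sum_range_succ]
    push_cast
    have h3 := hf (n + 1)
    rcases h n (Nat.lt_succ_self n) with h4 | h4
    · have h5 := h2 h4
      exact ⟨by linarith, fun h6 => by linarith⟩
    · exact ⟨by linarith, fun h6 => by linarith⟩

/-- The edges of the facial cycle between the levels `i` and `i + 2` whose top vertex is on the
side `q`. -/
def ladderCycle (i : Fin k) (q : Bool) : Finset (Fin (k + 1) × Bool × Bool) :=
  {(i.castSucc, true, true), (i.castSucc, true, false), (i.succ, false, q), (i.succ, true, q)}

lemma isCycle_ladderCycle (i : Fin k) (q : Bool) :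
    IsCycle (graphOfEnds lowEnd highEnd)
      (ladderCycle i q : Set (Fin (k + 1) × Bool × Bool)) := by
  refine ⟨3, ![(i.castSucc.castSucc, true), (i.castSucc.succ, false), (i.succ.succ, q),
    (i.castSucc.succ, true)], ![(i.castSucc, true, false), (i.succ, false, q), (i.succ, true, q),
    (i.castSucc, true, true)], ?_, ?_, ?_, ?_⟩
  · intro a b hab
    fin_cases a <;> fin_cases b <;> simp [Fin.ext_iff] at hab ⊢ <;> omega
  · intro a b hab
    fin_cases a <;> fin_cases b <;> simp [Fin.ext_iff] at hab ⊢
  · ext e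
    simp only [ladderCycle, Matrix.range_cons, Matrix.range_empty, Finset.coe_insert,
      Finset.coe_singleton, Set.mem_union, Set.mem_insert_iff, Set.mem_singleton_iff,
      Set.union_empty]
    tauto
  · intro a
    fin_cases a
    · exact Or.inl ⟨rfl, rfl⟩
    · exact Or.inl ⟨rfl, rfl⟩
    · exact Or.inr ⟨rfl, rfl⟩
    · exact Or.inr ⟨rfl, rfl⟩

lemma existsUnique_demand_ladderCycle (i : Fin k) (q : Bool) :
    ∃! e, e ∈ ladderCycle i q ∧ e.2.1 = false := by
  refine ⟨(i.succ, false, q), by simp [ladderCycle], ?_⟩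
  rintro e ⟨he, hd⟩
  simp only [ladderCycle, Finset.mem_insert, Finset.mem_singleton] at he
  rcases he with rfl | rfl | rfl | rfl <;> simp_all

lemma ladderCycle_mem_dCycles (i : Fin k) (q : Bool) :
    ladderCycle i q ∈ dCycles (ladderInst k) :=
  ⟨isCycle_ladderCycle i q, existsUnique_demand_ladderCycle i q⟩

lemma sum_ladderCycle (y : Fin (k + 1) × Bool × Bool → ℝ) (i : Fin k) (q : Bool) :
    ∑ e ∈ ladderCycle i q, y e = y (i.castSucc, true, true) + (y (i.castSucc, true, false) +
      (y (i.succ, false, q) + y (i.succ, true, q))) := by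
  rw [ladderCycle, Finset.sum_insert (by simp [Fin.ext_iff]),
    Finset.sum_insert (by simp [Fin.ext_iff]), Finset.sum_insert (by simp), Finset.sum_singleton]

lemma le_ladder_ipValue : ENNReal.ofReal k ≤ ipValue (dCycles (ladderInst k)) := by
  refine le_iInf₂ fun y hy => ENNReal.ofReal_le_ofReal ?_
  change Fin (k + 1) × Bool × Bool → ℝ at y
  obtain ⟨⟨hcov, hy0⟩, hint⟩ := hy
  change (k : ℝ) ≤ ∑ e : Fin (k + 1) × Bool × Bool, y e
  let f : ℕ → ℝ := fun j => if h : j < k + 1 then ∑ x : Bool × Bool, y (⟨j, h⟩, x) else 0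
  have hf : ∀ i : Fin (k + 1), f i =
      y (i, true, true) + y (i, true, false) + y (i, false, true) + y (i, false, false) := by
    intro i
    simp [f, Fintype.sum_prod_type, add_assoc, Nat.lt_succ_iff.1 i.2]
  have hsum : ∑ e, y e = ∑ j ∈ Finset.range (k + 1), f j := by
    rw [Fintype.sum_prod_type, ← Fin.sum_univ_eq_sum_range]
    refine Finset.sum_congr rfl fun i _ => ?_
    simp [f, Nat.lt_succ_iff.1 i.2]
  rw [hsum]
  refine (le_sum_of_alternative (fun j => ?_) fun j hj => ?_).1
  · by_cases h : j < k + 1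
    · simp only [f, h, dif_pos]
      exact Finset.sum_nonneg fun x _ => hy0 _
    · simp only [f, h, dif_neg, not_false_eq_true, le_refl]
  · have h1 := hf (Fin.castSucc ⟨j, hj⟩)
    have h2 := hf (Fin.succ ⟨j, hj⟩)
    have hc : ∀ q, 1 ≤ y (Fin.castSucc ⟨j, hj⟩, true, true) +
        (y (Fin.castSucc ⟨j, hj⟩, true, false) + (y (Fin.succ ⟨j, hj⟩, false, q) +
          y (Fin.succ ⟨j, hj⟩, true, q))) := by
      intro q
      rw [← sum_ladderCycle]
      exact hcov _ (ladderCycle_mem_dCycles ⟨j, hj⟩ q)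
    have hct := hc true
    have hcf := hc false
    have n1 := hy0 (Fin.castSucc ⟨j, hj⟩, true, true)
    have n2 := hy0 (Fin.castSucc ⟨j, hj⟩, true, false)
    have n3 := hy0 (Fin.castSucc ⟨j, hj⟩, false, true)
    have n4 := hy0 (Fin.castSucc ⟨j, hj⟩, false, false)
    simp only [Fin.val_castSucc, Fin.val_succ] at h1 h2
    rw [h1, h2]
    obtain ⟨a, ha⟩ := hint (Fin.castSucc ⟨j, hj⟩, true, true)
    obtain ⟨b, hb⟩ := hint (Fin.castSucc ⟨j, hj⟩, true, false)
    -- Integrality enters here: the two supply edges that leave `(j, true)` upwards carry at least 1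
    -- or nothing. If nothing, the constraints for `q = true` and `q = false` use disjoint pairs of
    -- edges on the next level, which together carry at least 2.
    rcases le_or_gt 1 (a + b) with hab | hab
    · left
      have : (1 : ℝ) ≤ a + b := by exact_mod_cast hab
      linarith
    · right
      have : (a + b : ℝ) ≤ 0 := by exact_mod_cast Int.lt_add_one_iff.1 hab
      linarith

/-! ### The limit of the ratios, for cycles and, through the dual, for cuts. -/

lemma ladder_ratio : ENNReal.ofReal (3 / 2 * (k / (k + 1))) ≤
    ipValue (dCycles (ladderInst k)) / lpValue (dCycles (ladderInst k)) := by
  refine le_trans (le_of_eq ?_) (ENNReal.div_le_div le_ladder_ipValue ladder_lpValue_le)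
  rw [← ENNReal.ofReal_div_of_pos (by positivity)]
  congr 1
  field_simp

lemma three_halves_le {c : ℝ≥0∞} (h : ∀ k : ℕ, ENNReal.ofReal (3 / 2 * (k / (k + 1))) ≤ c) :
    3 / 2 ≤ c := by
  have h1 : Filter.Tendsto (fun k : ℕ => ENNReal.ofReal (3 / 2 * (k / (k + 1)))) Filter.atTop
      (nhds (ENNReal.ofReal (3 / 2 * 1))) :=
    ENNReal.tendsto_ofReal ((tendsto_natCast_div_add_atTop (1 : ℝ)).const_mul _)
  have h2 := le_of_tendsto' h1 h
  rw [mul_one, ENNReal.ofReal_div_of_pos two_pos] at h2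
  simpa using h2

theorem three_halves_le_gap_dCycles : 3 / 2 ≤ integralityGap IsPlanar dCycles :=
  three_halves_le fun k => ladder_ratio.trans
    (le_iSup₂ (f := fun I (_ : IsPlanar I) => ipValue (dCycles I) / lpValue (dCycles I))
      (ladderInst k) ladder_planar)

theorem three_halves_le_gap_dCuts : 3 / 2 ≤ integralityGap IsPlanar dCuts := by
  refine three_halves_le fun k => ?_
  have : Nonempty (ladderInst k).Edge :=
    inferInstanceAs (Nonempty (Fin (k + 1) × Bool × Bool))
  obtain ⟨J, hJ, hlp, hip⟩ := exists_dual (ladderInst k) ladderTail_isLink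
    ladderRotation_sameCycle_iff ladder_euler fun x => ⟨ladderDart x, ladderTail_dart x⟩
  have h := ladder_ratio (k := k)
  rw [← hlp, ← hip] at h
  exact h.trans
    (le_iSup₂ (f := fun I (_ : IsPlanar I) => ipValue (dCuts I) / lpValue (dCuts I)) J hJ)

end Ladder

end DCover

theorem mainTheorem7 :
    DCover.integralityGap (fun _ => True) DCover.dCuts ≤ 2 ∧
    DCover.integralityGap DCover.IsPlanar DCover.dCycles ≤ 2 ∧
    3 / 2 ≤ DCover.integralityGap DCover.IsPlanar DCover.dCuts ∧
    3 / 2 ≤ DCover.integralityGap DCover.IsPlanar DCover.dCycles :=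
  ⟨DCover.integralityGap_dCuts_le, DCover.integralityGap_dCycles_le,
    DCover.three_halves_le_gap_dCuts, DCover.three_halves_le_gap_dCycles⟩
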